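/- **Setting.** Let $\mathcal L_{\mathbb N}$ be the language of Peano arithmetic extended by finitely many function symbols for primitive recursive functions, among them symbols $\underset{\cdot}{=},\underset{\cdot}{\neg},\underset{\cdot}{\vee},\underset{\cdot}{\wedge},\underset{\cdot}{\forall},\underset{\cdot}{\exists}$ for the syntactic operations on codes, $\mathrm{num}$ for $n\mapsto$ the code of the numeral $\bar n$, and a symbol for substitution, $x(t/v)$. Let $\mathcal L_{\mathrm{Tr}}=\mathcal L_{\mathbb N}\cup\{\mathrm{Tr}\}$ with $\mathrm{Tr}$ a unary predicate; $\varphi\to\psi$ abbreviates $\neg\varphi\vee\psi$. Write $\#\varphi$ for the code of $\varphi$, $\ulcorner\varphi\urcorner$ for the numeral of $\#\varphi$, and $\ulcorner\varphi(\dot x)\urcorner$ for $\ulcorner\varphi(v)\urcorner(\mathrm{num}(x)/\ulcorner v\urcorner)$. $\mathrm{PAT}$ is $\mathrm{PA}$ (with the defining axioms of the function symbols) with induction for all formulas of $\mathcal L_{\mathrm{Tr}}$. The formulas $\mathrm{CT}(x)$, $\mathrm{Sent}(x)$, $\mathrm{Ax}_{\mathrm{PAT}}(x)$ of $\mathcal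 L_{\mathbb N}$ express that $x$ codes a closed term, a sentence of $\mathcal L_{\mathrm{Tr}}$, and a (logical or non-logical) axiom of $\mathrm{PAT}$, the axioms being taken as sentences; $x^\circ=y^\circ$ is the formula expressing that the closed terms coded by $x$ and $y$ have the same value. For a set $X$ of codes of $\mathcal L_{\mathrm{Tr}}$-sentences let $X^-=\{\#\varphi : \#\neg\varphi\in X\}$, and call $X$ consistent if $X\cap X^-=\varnothing$. Put $X\vDash_{\mathrm{vb}}\varphi$ iff $(\mathbb N,X')\vDash\varphi$ for every set $X'$ of codes of sentences with $X'\supseteq X$ and $X'\cap X^-=\varnothing$, and $\mathcal J_{\mathrm{vb}}(X)=\{\#\varphi : \varphi \text{ a sentence of }\mathcal L_{\mathrm{Tr}},\ X\vDash_{\mathrm{vb}}\varphi\}$. (So admissible extensions are required to be consistent only relative to the given set $X$.) The theory $\mathrm{VF}^-$ consists of $\mathrm{PAT}$ and the universal closures of 1. $\mathrm{CT}(x)\wedge\mathrm{CT}(y)\to[(\mathrm{Tr}(x\underset{\cdot}{=}y)\leftrightarrow x^\circ=y^\circ)\wedge(\mathrm{Tr}(\underset{\cdot}{\neg}(x\underset{\cdot}{=}y))\leftrightarrow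 x^\circ\neq y^\circ)]$; 2. $\mathrm{Ax}_{\mathrm{PAT}}(x)\to\mathrm{Tr}(x)$; 3. $\forall z\,\mathrm{Tr}(x(\mathrm{num}(z)/v))\to\mathrm{Tr}(\underset{\cdot}{\forall}v\,x)$; 4. $\mathrm{Tr}(x)\to\mathrm{Tr}\ulcorner\mathrm{Tr}(\dot x)\urcorner$; 5. $\mathrm{Sent}(x)\to(\mathrm{Tr}\ulcorner\neg\mathrm{Tr}(\dot x)\urcorner\leftrightarrow\mathrm{Tr}(\underset{\cdot}{\neg}x))$; 6. $\mathrm{Tr}(x\underset{\cdot}{\to}y)\to(\mathrm{Tr}(x)\to\mathrm{Tr}(y))$, where $x\underset{\cdot}{\to}y$ is $(\underset{\cdot}{\neg}x)\underset{\cdot}{\vee}y$; 7. $\mathrm{Tr}(x)\to\mathrm{Tr}\ulcorner\neg\mathrm{Tr}(\underset{\cdot}{\neg}\dot x)\urcorner$; 8. $\mathrm{Tr}\ulcorner\mathrm{Tr}(\dot x)\to\mathrm{Sent}(\dot x)\urcorner$; 9. $\mathrm{Tr}\ulcorner\varphi\urcorner\to\varphi$ for every formula $\varphi$ of $\mathcal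 L_{\mathrm{Tr}}$ (where any variables of $\varphi$ may be dotted inside the corner quotes). **Proposition** ($\mathrm{VF}^-$ is sound with respect to the scheme VB). If $X$ is consistent and $X=\mathcal J_{\mathrm{vb}}(X)$, then $(\mathbb N,X)\vDash\mathrm{VF}^-$. -/

import Mathlib

noncomputable section

namespace VB

/-! ### The language `L_Tr`

Terms and formulas with named variables `v_0, v_1, …`; the logical symbols are
`¬, ∨, ∧, ∀, ∃` and equality, and `→` is an abbreviation.  The base language `L_ℕ` (the formulas
without `Tr`) is the language of arithmetic with symbols for finitely many primitive recursive
functions: pairing, Gödel's beta function, the operations on codes `¬. =. ∨. ∧. ∀. ∃.`, the numeral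
function and the substitution function. -/

/-- Unary function symbols: successor, `¬.` and `num`. -/
inductive F1 where
  | succ | neg | num

/-- Binary function symbols: `+`, `×`, pairing, beta, and `=.`, `∨.`, `∧.`, `∀.`, `∃.`. -/
inductive F2 where
  | add | mul | pair | beta | eq | or | and | all | ex

/-- Terms; `sub x t v` is the term `x(t/v)`, with a ternary function symbol. -/
inductive Tm where
  | var (i : ℕ)
  | zero
  | app1 (f : F1) (t : Tm)
  | app2 (f : F2) (s t : Tm)
  | sub (x t v : Tm)

/-- Formulas of `L_Tr`. -/
inductive Fm where
  | eq (s t : Tm)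
  | tr (t : Tm)
  | neg (φ : Fm)
  | or (φ ψ : Fm)
  | and (φ ψ : Fm)
  | all (i : ℕ) (φ : Fm)
  | ex (i : ℕ) (φ : Fm)

def Fm.imp (φ ψ : Fm) : Fm := .or (.neg φ) ψ

def Fm.iff (φ ψ : Fm) : Fm := .and (.imp φ ψ) (.imp ψ φ)

/-- The variables of a term. -/
def Tm.vars : Tm → Finset ℕ
  | .var i => {i}
  | .zero => ∅
  | .app1 _ t => t.vars
  | .app2 _ s t => s.vars ∪ t.vars
  | .sub x t v => x.vars ∪ t.vars ∪ v.vars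

/-- The free variables of a formula. -/
def Fm.fv : Fm → Finset ℕ
  | .eq s t => s.vars ∪ t.vars
  | .tr t => t.vars
  | .neg φ => φ.fv
  | .or φ ψ => φ.fv ∪ ψ.fv
  | .and φ ψ => φ.fv ∪ ψ.fv
  | .all i φ => φ.fv.erase i
  | .ex i φ => φ.fv.erase i

def Fm.IsSentence (φ : Fm) : Prop := φ.fv = ∅

/-- Replace the variable `v_i` by the term `u`. -/
def Tm.subst : Tm → ℕ → Tm → Tm
  | .var j, i, u => if j = i then u else .var j
  | .zero, _, _ => .zero
  | .app1 f t, i, u => .app1 f (t.subst i u)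
  | .app2 f s t, i, u => .app2 f (s.subst i u) (t.subst i u)
  | .sub x t v, i, u => .sub (x.subst i u) (t.subst i u) (v.subst i u)

/-- Replace the free occurrences of the variable `v_i` by the term `u` (no renaming). -/
def Fm.subst : Fm → ℕ → Tm → Fm
  | .eq s t, i, u => .eq (s.subst i u) (t.subst i u)
  | .tr t, i, u => .tr (t.subst i u)
  | .neg φ, i, u => .neg (φ.subst i u)
  | .or φ ψ, i, u => .or (φ.subst i u) (ψ.subst i u)
  | .and φ ψ, i, u => .and (φ.subst i u) (ψ.subst i u)
  | .all j φ, i, u => if j = i then .all j φ else .all j (φ.subst i u)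
  | .ex j φ, i, u => if j = i then .ex j φ else .ex j (φ.subst i u)

/-- The numeral `S … S 0` of a number. -/
def Tm.numeral : ℕ → Tm
  | 0 => .zero
  | n + 1 => .app1 .succ (Tm.numeral n)

/-! ### Gödel numbering -/

def F1.idx : F1 → ℕ
  | .succ => 0
  | .neg => 1
  | .num => 2

def F2.idx : F2 → ℕ
  | .add => 0
  | .mul => 1
  | .pair => 2
  | .beta => 3
  | .eq => 4
  | .or => 5
  | .and => 6
  | .all => 7
  | .ex => 8

/-- The Gödel number of a term. -/
def Tm.code : Tm → ℕ
  | .var i => Nat.pair 1 i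
  | .zero => Nat.pair 2 0
  | .app1 f t => Nat.pair 3 (Nat.pair f.idx t.code)
  | .app2 f s t => Nat.pair 4 (Nat.pair f.idx (Nat.pair s.code t.code))
  | .sub x t v => Nat.pair 5 (Nat.pair x.code (Nat.pair t.code v.code))

/-- The Gödel number `#φ` of a formula. -/
def Fm.code : Fm → ℕ
  | .eq s t => Nat.pair 6 (Nat.pair s.code t.code)
  | .tr t => Nat.pair 7 t.code
  | .neg φ => Nat.pair 8 φ.code
  | .or φ ψ => Nat.pair 9 (Nat.pair φ.code ψ.code)
  | .and φ ψ => Nat.pair 10 (Nat.pair φ.code ψ.code)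
  | .all i φ => Nat.pair 11 (Nat.pair (Tm.var i).code φ.code)
  | .ex i φ => Nat.pair 12 (Nat.pair (Tm.var i).code φ.code)

/-- The set of codes of sentences of `L_Tr`. -/
def SentCodes : Set ℕ := {n | ∃ φ : Fm, φ.IsSentence ∧ n = φ.code}

/-! ### The standard interpretation -/

/-- The substitution function: if `x` codes a formula (or term), `t` a term and `v` a variable, it
yields the code of the result of replacing the variable by the term; otherwise `0`, which codes
nothing. -/
def subFun (x t v : ℕ) : ℕ :=
  match Function.partialInv Tm.code t, Function.partialInv Tm.code v with
  | some u, some (.var i) =>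
    match Function.partialInv Fm.code x, Function.partialInv Tm.code x with
    | some φ, _ => (φ.subst i u).code
    | none, some s => (s.subst i u).code
    | none, none => 0
  | _, _ => 0

def F1.interp : F1 → ℕ → ℕ
  | .succ, n => n + 1
  | .neg, n => Nat.pair 8 n
  | .num, n => (Tm.numeral n).code

def F2.interp : F2 → ℕ → ℕ → ℕ
  | .add, m, n => m + n
  | .mul, m, n => m * n
  | .pair, m, n => Nat.pair m n
  | .beta, m, n => Nat.beta m n
  | .eq, m, n => Nat.pair 6 (Nat.pair m n)
  | .or, m, n => Nat.pair 9 (Nat.pair m n)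
  | .and, m, n => Nat.pair 10 (Nat.pair m n)
  | .all, m, n => Nat.pair 11 (Nat.pair m n)
  | .ex, m, n => Nat.pair 12 (Nat.pair m n)

/-- The value of a term in the standard model under a variable assignment. -/
def Tm.eval (e : ℕ → ℕ) : Tm → ℕ
  | .var i => e i
  | .zero => 0
  | .app1 f t => f.interp (t.eval e)
  | .app2 f s t => f.interp (s.eval e) (t.eval e)
  | .sub x t v => subFun (x.eval e) (t.eval e) (v.eval e)

/-- Classical satisfaction in `(ℕ, X)`, where `X` interprets `Tr`. -/
def Fm.Sat (X : Set ℕ) (e : ℕ → ℕ) : Fm → Prop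
  | .eq s t => s.eval e = t.eval e
  | .tr t => t.eval e ∈ X
  | .neg φ => ¬ φ.Sat X e
  | .or φ ψ => φ.Sat X e ∨ ψ.Sat X e
  | .and φ ψ => φ.Sat X e ∧ ψ.Sat X e
  | .all i φ => ∀ n : ℕ, φ.Sat X (Function.update e i n)
  | .ex i φ => ∃ n : ℕ, φ.Sat X (Function.update e i n)

/-- `(ℕ, X) ⊨ φ`. -/
def Holds (X : Set ℕ) (φ : Fm) : Prop := ∀ e : ℕ → ℕ, φ.Sat X e

/-- `(ℕ, X) ⊨ T` for a set `T` of sentences. -/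
def Models (X : Set ℕ) (T : Set Fm) : Prop := ∀ φ ∈ T, Holds X φ

/-! ### The supervaluational scheme VB -/

/-- The antiextension `X⁻ = {#φ | #¬φ ∈ X}`. -/
def anti (X : Set ℕ) : Set ℕ := {n | ∃ φ : Fm, φ.IsSentence ∧ n = φ.code ∧ (Fm.neg φ).code ∈ X}

/-- No sentence belongs to `X` together with its negation. -/
def Consistent (X : Set ℕ) : Prop := X ∩ anti X = ∅

/-- `X ⊨_vb φ`; the interpretations `X'` of `Tr` are sets of codes of sentences. -/
def SatVB (X : Set ℕ) (φ : Fm) : Prop :=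
  ∀ X' : Set ℕ, X' ⊆ SentCodes → X ⊆ X' → X' ∩ anti X = ∅ → Holds X' φ

/-- The Kripke jump of the scheme VB. -/
def jumpVB (X : Set ℕ) : Set ℕ := {n | ∃ φ : Fm, φ.IsSentence ∧ n = φ.code ∧ SatVB X φ}

/-! ### Arithmetized syntax: auxiliary terms and formulas

The formulas below take a level `k` and terms that contain only variables `v_i` with `i < k`;
their own bound variables are `v_k, v_{k+1}, …`, so that no clash can occur. -/

abbrev Tm.succ (t : Tm) : Tm := .app1 .succ t
abbrev Tm.num (t : Tm) : Tm := .app1 .num t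
abbrev Tm.dneg (t : Tm) : Tm := .app1 .neg t
abbrev Tm.add (s t : Tm) : Tm := .app2 .add s t
abbrev Tm.mul (s t : Tm) : Tm := .app2 .mul s t
abbrev Tm.pr (s t : Tm) : Tm := .app2 .pair s t
abbrev Tm.beta (s t : Tm) : Tm := .app2 .beta s t
abbrev Tm.deq (s t : Tm) : Tm := .app2 .eq s t
abbrev Tm.dor (s t : Tm) : Tm := .app2 .or s t
abbrev Tm.dand (s t : Tm) : Tm := .app2 .and s t
abbrev Tm.dall (v x : Tm) : Tm := .app2 .all v x
abbrev Tm.dex (v x : Tm) : Tm := .app2 .ex v x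
/-- `x →. y`. -/
abbrev Tm.dimp (x y : Tm) : Tm := .dor (.dneg x) y

/-- The code of the term `0`, as a closed term. -/
def dzero : Tm := .numeral Tm.zero.code
/-- The code of `v_x`. -/
def dvar (x : Tm) : Tm := .pr (.numeral 1) x
/-- The code of `f(x)`, from the code `x`. -/
def dapp1 (f : F1) (x : Tm) : Tm := .pr (.numeral 3) (.pr (.numeral f.idx) x)
/-- The code of `f(x, y)`, from the codes `x`, `y`. -/
def dapp2 (f : F2) (x y : Tm) : Tm := .pr (.numeral 4) (.pr (.numeral f.idx) (.pr x y))
/-- The code of `x(y/z)`, from the codes `x`, `y`, `z`. -/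
def dsub (x y z : Tm) : Tm := .pr (.numeral 5) (.pr x (.pr y z))
/-- The code of `Tr(x)`, from the code `x`. -/
def dtr (x : Tm) : Tm := .pr (.numeral 7) x

/-- The numeral `⌜φ⌝` of the code of `φ`. -/
def quo (φ : Fm) : Tm := .numeral φ.code
/-- The numeral `⌜v_i⌝`. -/
def quoVar (i : ℕ) : Tm := .numeral (Tm.var i).code

/-- `⌜φ(ẋ)⌝`, where the variable `v_i` of `φ` is the dotted one. -/
def dot (φ : Fm) (i : ℕ) (x : Tm) : Tm := .sub (quo φ) (.num x) (quoVar i)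

def F1.list : List F1 := [.succ, .neg, .num]
def F2.list : List F2 := [.add, .mul, .pair, .beta, .eq, .or, .and, .all, .ex]

def Fm.disj (l : List Fm) : Fm := l.foldr .or (.eq .zero (.succ .zero))
abbrev exF (k : ℕ) (body : Tm → Fm) : Fm := .ex k (body (.var k))
abbrev allF (k : ℕ) (body : Tm → Fm) : Fm := .all k (body (.var k))

/-- `x ≤ y`. -/
def leF (k : ℕ) (x y : Tm) : Fm := exF k fun z => .eq (.add x z) y
/-- `x < y`. -/
def ltF (k : ℕ) (x y : Tm) : Fm := exF k fun z => .eq (.add x (.succ z)) y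

/-- Membership of `x` in the set generated by a rule: there is a finite sequence (coded by
beta) with last entry `x`, each entry `c` of which is obtained by the rule from earlier entries.
The rule is `step m c prev`, with `prev m y` saying that `y` is an entry before `c`. -/
def genF (k : ℕ) (step : ℕ → Tm → (ℕ → Tm → Fm) → Fm) (x : Tm) : Fm :=
  exF k fun s => exF (k + 1) fun n => .and (.eq (.beta s n) x) <|
    allF (k + 2) fun i => .imp (leF (k + 3) i n) <|
      step (k + 3) (.beta s i) fun m y =>
        exF m fun j => .and (ltF (m + 1) j i) (.eq (.beta s j) y)

/-- `Var(x)`. -/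
def varF (k : ℕ) (x : Tm) : Fm := exF k fun i => .eq x (dvar i)

def ctStep (k : ℕ) (c : Tm) (prev : ℕ → Tm → Fm) : Fm :=
  Fm.disj <|
    [.eq c dzero] ++
    F1.list.map (fun f => exF k fun a => .and (prev (k + 1) a) (.eq c (dapp1 f a))) ++
    F2.list.map (fun f => exF k fun a => exF (k + 1) fun b =>
      .and (prev (k + 2) a) (.and (prev (k + 2) b) (.eq c (dapp2 f a b)))) ++
    [exF k fun a => exF (k + 1) fun b => exF (k + 2) fun d =>
      .and (prev (k + 3) a) (.and (prev (k + 3) b) (.and (prev (k + 3) d) (.eq c (dsub a b d))))]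

/-- `CT(x)`: `x` codes a closed term. -/
def ctF (k : ℕ) (x : Tm) : Fm := genF k ctStep x

/-- `x` codes a term. -/
def termF (k : ℕ) (x : Tm) : Fm :=
  genF k (fun m c prev => .or (varF m c) (ctStep m c prev)) x

def forStep (k : ℕ) (c : Tm) (prev : ℕ → Tm → Fm) : Fm :=
  Fm.disj
    [exF k fun a => exF (k + 1) fun b =>
      .and (termF (k + 2) a) (.and (termF (k + 2) b) (.eq c (.deq a b))),
    exF k fun a => .and (termF (k + 1) a) (.eq c (dtr a)),
    exF k fun a => .and (prev (k + 1) a) (.eq c (.dneg a)),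
    exF k fun a => exF (k + 1) fun b =>
      .and (prev (k + 2) a) (.and (prev (k + 2) b) (.eq c (.dor a b))),
    exF k fun a => exF (k + 1) fun b =>
      .and (prev (k + 2) a) (.and (prev (k + 2) b) (.eq c (.dand a b))),
    exF k fun u => exF (k + 1) fun a =>
      .and (varF (k + 2) u) (.and (prev (k + 2) a) (.eq c (.dall u a))),
    exF k fun u => exF (k + 1) fun a =>
      .and (varF (k + 2) u) (.and (prev (k + 2) a) (.eq c (.dex u a)))]

/-- `For(x)`: `x` codes a formula of `L_Tr`. -/
def forF (k : ℕ) (x : Tm) : Fm := genF k forStep x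

/-- The variable (with code) `v` does not occur free in the term or formula (with code) `x`:
replacing it by `0` changes nothing. -/
def notFree (v x : Tm) : Fm := .eq (.sub x dzero v) x

/-- `Sent(x)`: `x` codes a sentence of `L_Tr`. -/
def sentF (k : ℕ) (x : Tm) : Fm :=
  .and (forF k x) (allF k fun v => .imp (varF (k + 1) v) (notFree v x))

/-- The closed term (with code) `x` has the value `y`. -/
def valF (k : ℕ) (x y : Tm) : Fm :=
  genF k (fun k c prev => Fm.disj <|
    [.eq c (.pr dzero .zero)] ++
    F1.list.map (fun f => exF k fun a => exF (k + 1) fun m =>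
      .and (prev (k + 2) (.pr a m)) (.eq c (.pr (dapp1 f a) (.app1 f m)))) ++
    F2.list.map (fun f => exF k fun a => exF (k + 1) fun b => exF (k + 2) fun m =>
      exF (k + 3) fun n => .and (prev (k + 4) (.pr a m)) (.and (prev (k + 4) (.pr b n))
        (.eq c (.pr (dapp2 f a b) (.app2 f m n))))) ++
    [exF k fun a => exF (k + 1) fun b => exF (k + 2) fun d => exF (k + 3) fun m =>
      exF (k + 4) fun n => exF (k + 5) fun p =>
        .and (prev (k + 6) (.pr a m)) (.and (prev (k + 6) (.pr b n))
          (.and (prev (k + 6) (.pr d p)) (.eq c (.pr (dsub a b d) (.sub m n p)))))])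
    (.pr x y)

/-- `x° = y°`. -/
def valEqF (k : ℕ) (x y : Tm) : Fm :=
  exF k fun a => exF (k + 1) fun b =>
    .and (valF (k + 2) x a) (.and (valF (k + 2) y b) (.eq a b))

/-- The term `t` is free for the variable `v` in the formula `x` (all given by codes). -/
def freeForF (k : ℕ) (t v x : Tm) : Fm :=
  genF k (fun k c prev => Fm.disj
    [exF k fun a => exF (k + 1) fun b =>
      .and (termF (k + 2) a) (.and (termF (k + 2) b) (.eq c (.deq a b))),
    exF k fun a => .and (termF (k + 1) a) (.eq c (dtr a)),
    exF k fun a => .and (prev (k + 1) a) (.eq c (.dneg a)),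
    exF k fun a => exF (k + 1) fun b =>
      .and (prev (k + 2) a) (.and (prev (k + 2) b) (.eq c (.dor a b))),
    exF k fun a => exF (k + 1) fun b =>
      .and (prev (k + 2) a) (.and (prev (k + 2) b) (.eq c (.dand a b))),
    exF k fun u => exF (k + 1) fun a => .and (varF (k + 2) u) <| .and (forF (k + 2) a) <|
      .and (.or (.eq c (.dall u a)) (.eq c (.dex u a))) <|
      .or (notFree v c) (.and (notFree u t) (prev (k + 2) a))])
    x

/-! ### Peano arithmetic with full induction, `PAT`, and its arithmetization -/

/-- `sub` is applied to a variable `v`, a term `t` and, in `x`, to a term or formula. -/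
def subGuard (t v : Tm) (rest : Fm) (concl : Fm) : Fm :=
  .imp (.and (.and (varF 5 v) (termF 5 t)) rest) concl

/-- The recursion equations of the substitution function. -/
def subAx : List Fm :=
  let x := Tm.var 0
  let t := Tm.var 1
  let v := Tm.var 2
  let y := Tm.var 3
  let z := Tm.var 4
  let s := fun a : Tm => Tm.sub a t v
  let tt := Fm.eq .zero .zero
  [subGuard t v tt (.eq (s v) t),
   subGuard t v (.and (varF 5 x) (.neg (.eq x v))) (.eq (s x) x),
   subGuard t v tt (.eq (s dzero) dzero)] ++
  F1.list.map (fun f => subGuard t v (termF 5 x) (.eq (s (dapp1 f x)) (dapp1 f (s x)))) ++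
  F2.list.map (fun f => subGuard t v (.and (termF 5 x) (termF 5 y))
    (.eq (s (dapp2 f x y)) (dapp2 f (s x) (s y)))) ++
  [subGuard t v (.and (termF 5 x) (.and (termF 5 y) (termF 5 z)))
    (.eq (s (dsub x y z)) (dsub (s x) (s y) (s z))),
   subGuard t v (.and (termF 5 x) (termF 5 y)) (.eq (s (.deq x y)) (.deq (s x) (s y))),
   subGuard t v (termF 5 x) (.eq (s (dtr x)) (dtr (s x))),
   subGuard t v (forF 5 x) (.eq (s (.dneg x)) (.dneg (s x))),
   subGuard t v (.and (forF 5 x) (forF 5 y)) (.eq (s (.dor x y)) (.dor (s x) (s y))),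
   subGuard t v (.and (forF 5 x) (forF 5 y)) (.eq (s (.dand x y)) (.dand (s x) (s y))),
   subGuard t v (forF 5 x) (.eq (s (.dall v x)) (.dall v x)),
   subGuard t v (forF 5 x) (.eq (s (.dex v x)) (.dex v x)),
   subGuard t v (.and (forF 5 x) (.and (varF 5 y) (.neg (.eq y v))))
    (.eq (s (.dall y x)) (.dall y (s x))),
   subGuard t v (.and (forF 5 x) (.and (varF 5 y) (.neg (.eq y v))))
    (.eq (s (.dex y x)) (.dex y (s x))),
   .imp (.neg (.and (.and (varF 5 v) (termF 5 t)) (.or (termF 5 x) (forF 5 x))))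
    (.eq (s x) .zero)]

/-- The axioms of `PA` other than induction, up to universal closure: the axioms for
`0, S, +, ×` and the defining axioms of the remaining function symbols. -/
def paList : List Fm :=
  let x := Tm.var 0
  let y := Tm.var 1
  let z := Tm.var 2
  [.neg (.eq (.succ x) .zero),
   .imp (.eq (.succ x) (.succ y)) (.eq x y),
   .eq (.add x .zero) x,
   .eq (.add x (.succ y)) (.succ (.add x y)),
   .eq (.mul x .zero) .zero,
   .eq (.mul x (.succ y)) (.add (.mul x y) x),
   .imp (ltF 2 x y) (.eq (.pr x y) (.add (.mul y y) x)),
   .imp (.neg (ltF 2 x y)) (.eq (.pr x y) (.add (.add (.mul x x) x) y)),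
   .and (ltF 3 (.beta (.pr x y) z) (.succ (.mul (.succ z) y)))
    (exF 3 fun q => .eq x
      (.add (.mul q (.succ (.mul (.succ z) y))) (.beta (.pr x y) z))),
   .eq (.dneg x) (.pr (.numeral 8) x),
   .eq (.deq x y) (.pr (.numeral 6) (.pr x y)),
   .eq (.dor x y) (.pr (.numeral 9) (.pr x y)),
   .eq (.dand x y) (.pr (.numeral 10) (.pr x y)),
   .eq (.dall x y) (.pr (.numeral 11) (.pr x y)),
   .eq (.dex x y) (.pr (.numeral 12) (.pr x y)),
   .eq (.num .zero) dzero,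
   .eq (.num (.succ x)) (dapp1 .succ (.num x))] ++ subAx

/-- The induction axiom for `φ` with respect to `v_i`. -/
def indAx (i : ℕ) (φ : Fm) : Fm :=
  .imp (.and (φ.subst i .zero) (.all i (.imp φ (φ.subst i (.succ (.var i)))))) (.all i φ)

/-- The sentences that arise from the members of `A` by prefixing universal quantifiers. -/
def closures (A : Set Fm) : Set Fm :=
  {ψ | ψ.IsSentence ∧ ∃ φ ∈ A, ∃ l : List ℕ, ψ = l.foldr Fm.all φ}

/-- The theory `PAT`: `PA` with induction for all formulas of `L_Tr`. -/
def PAT : Set Fm := closures ({φ | φ ∈ paList} ∪ {φ | ∃ i χ, φ = indAx i χ})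

/-- `y` codes a logical axiom up to universal closure: propositional logic, quantifiers, equality
(a Hilbert system in which modus ponens, on sentences, is the only rule). -/
def logAxF (k : ℕ) (y : Tm) : Fm :=
  exF k fun a => exF (k + 1) fun b => exF (k + 2) fun c => exF (k + 3) fun v =>
  exF (k + 4) fun s => exF (k + 5) fun t =>
  .and (.and (forF (k + 6) a) (.and (forF (k + 6) b) (forF (k + 6) c))) <|
  .and (.and (varF (k + 6) v) (.and (termF (k + 6) s) (termF (k + 6) t))) <|
  Fm.disj
    [.eq y (.dimp (.dor a a) a),
     .eq y (.dimp a (.dor a b)),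
     .eq y (.dimp (.dor a b) (.dor b a)),
     .eq y (.dimp (.dimp b c) (.dimp (.dor a b) (.dor a c))),
     .eq y (.dimp (.dand a b) a),
     .eq y (.dimp (.dand a b) b),
     .eq y (.dimp a (.dimp b (.dand a b))),
     .and (freeForF (k + 6) t v a) (.eq y (.dimp (.dall v a) (.sub a t v))),
     .eq y (.dimp (.dall v (.dimp a b)) (.dimp (.dall v a) (.dall v b))),
     .and (notFree v a) (.eq y (.dimp a (.dall v a))),
     .and (freeForF (k + 6) t v a) (.eq y (.dimp (.sub a t v) (.dex v a))),
     .and (notFree v b) (.eq y (.dimp (.dall v (.dimp a b)) (.dimp (.dex v a) b))),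
     .eq y (.deq t t),
     .and (.and (freeForF (k + 6) s v a) (freeForF (k + 6) t v a))
      (.eq y (.dimp (.deq s t) (.dimp (.sub a s v) (.sub a t v))))]

/-- `y` codes an axiom of `PA` with full induction, up to universal closure. -/
def patAxF (k : ℕ) (y : Tm) : Fm :=
  .or (Fm.disj (paList.map fun φ => .eq y (quo φ))) <|
  exF k fun a => exF (k + 1) fun v => .and (forF (k + 2) a) <| .and (varF (k + 2) v) <|
    .eq y (.dimp (.dand (.sub a dzero v) (.dall v (.dimp a (.sub a (dapp1 .succ v) v))))
      (.dall v a))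

/-- `x` arises from `y` by prefixing universal quantifiers. -/
def closureF (k : ℕ) (y x : Tm) : Fm :=
  genF k (fun k c prev => .or (.eq c y) <| exF k fun u => exF (k + 1) fun a =>
    .and (varF (k + 2) u) (.and (prev (k + 2) a) (.eq c (.dall u a)))) x

/-- `Ax_PAT(x)`: `x` codes a logical or non-logical axiom of `PAT`. -/
def axPATF (k : ℕ) (x : Tm) : Fm :=
  .and (sentF k x) <| exF k fun y =>
    .and (.or (logAxF (k + 1) y) (patAxF (k + 1) y)) (closureF (k + 1) y x)

/-! ### The theory `VF⁻` -/

/-- `⌜φ⌝` with all variables in the list `l` dotted. -/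
def dots (φ : Fm) (l : List ℕ) : Tm :=
  l.foldl (fun q i => .sub q (.num (.var i)) (quoVar i)) (quo φ)

/-- The truth axioms of `VF⁻`, before universal closure. -/
inductive TruthAx : Fm → Prop
  /-- `CT(x) ∧ CT(y) → (Tr(x =. y) ↔ x° = y°) ∧ (Tr(x ≠. y) ↔ x° ≠ y°)` -/
  | vf1 : TruthAx <| .imp (.and (ctF 2 (.var 0)) (ctF 2 (.var 1))) <|
      .and (.iff (.tr (.deq (.var 0) (.var 1))) (valEqF 2 (.var 0) (.var 1)))
        (.iff (.tr (.dneg (.deq (.var 0) (.var 1)))) (.neg (valEqF 2 (.var 0) (.var 1))))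
  /-- `Ax_PAT(x) → Tr(x)` -/
  | vf2 : TruthAx <| .imp (axPATF 1 (.var 0)) (.tr (.var 0))
  /-- `∀ z Tr(x(ż/v)) → Tr(∀. v x)` -/
  | vf3 : TruthAx <| .imp (.all 2 (.tr (.sub (.var 0) (.num (.var 2)) (.var 1))))
      (.tr (.dall (.var 1) (.var 0)))
  /-- `Tr(x) → Tr⌜Tr(ẋ)⌝` -/
  | vf4 : TruthAx <| .imp (.tr (.var 0)) (.tr (dot (.tr (.var 0)) 0 (.var 0)))
  /-- `Sent(x) → (Tr⌜¬Tr(ẋ)⌝ ↔ Tr(¬. x))` -/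
  | vf5 : TruthAx <| .imp (sentF 1 (.var 0)) <|
      .iff (.tr (dot (.neg (.tr (.var 0))) 0 (.var 0))) (.tr (.dneg (.var 0)))
  /-- `Tr(x →. y) → (Tr(x) → Tr(y))` -/
  | vf6 : TruthAx <| .imp (.tr (.dimp (.var 0) (.var 1))) (.imp (.tr (.var 0)) (.tr (.var 1)))
  /-- `Tr(x) → Tr⌜¬Tr(¬. ẋ)⌝` -/
  | vf7 : TruthAx <| .imp (.tr (.var 0)) (.tr (dot (.neg (.tr (.dneg (.var 0)))) 0 (.var 0)))
  /-- `Tr⌜Tr(ẋ) → Sent(ẋ)⌝` -/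
  | vf8 : TruthAx <| .tr (dot (.imp (.tr (.var 0)) (sentF 1 (.var 0))) 0 (.var 0))
  /-- `Tr⌜φ⌝ → φ` for every formula `φ`, any of whose variables may be dotted -/
  | vf9 (φ : Fm) (l : List ℕ) : TruthAx <| .imp (.tr (dots φ l)) φ

/-- The theory `VF⁻`. -/
def VFminus : Set Fm := PAT ∪ closures {φ | TruthAx φ}

end VB

end

namespace VB

/-! ### Injectivity of the Gödel numbering -/

/-! Call `X'` admissible if it is a set of codes of sentences that extends `X` and is disjoint from
`anti X`. Since `X` is a fixed point, the code of a sentence lies in `X` iff the sentence holds in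
`(ℕ, X')` for every admissible `X'` (`code_mem_iff`). Consistency of `X` says that `X` itself is
admissible (`admissible_self`).

The truth axioms follow from these two facts. Reflection (`vf9`) takes `X' = X`. Closure under modus
ponens and the ω-rule holds because each single `(ℕ, X')` has it. `vf4` is `X ⊆ X'`, and `vf8` holds
because admissible sets contain only codes of sentences. In `vf5`, one direction is disjointness of
`X'` from `anti X`. For the other, if the code of `φ` is not in `anti X`, then adding it to `X`
gives an admissible set where `φ` is called true. This works because consistency is demanded only
relative to `X`, so `X'` may contain both `φ` and its negation. `vf7` reduces to the fact that `¬¬φ`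
is in `X` whenever `φ` is.

The axioms of `PAT` hold in `(ℕ, X')` for every `X'` (`Valid`), which settles both `PAT` itself and
`vf2`.

Most of the work is to show that the concrete arithmetical formulas mean in `(ℕ, X)` what they
should. They are built from `genF`, which asserts a generating sequence coded by Gödel's beta
function. `genF_sat` reduces it to the set-theoretic `Gen`, which is then characterised by
`Gen.induction` and `Gen.intro`. -/

theorem F1.idx_injective : Function.Injective F1.idx := by
  intro f g h; cases f <;> cases g <;> simp_all [F1.idx]

theorem F2.idx_injective : Function.Injective F2.idx := by
  intro f g h; cases f <;> cases g <;> simp_all [F2.idx]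

theorem Tm.code_injective : Function.Injective Tm.code := by
  intro s
  induction s with
  | var i => intro t h; cases t <;> simp_all [Tm.code, Nat.pair_eq_pair]
  | zero => intro t h; cases t <;> simp_all [Tm.code, Nat.pair_eq_pair]
  | app1 f s ih =>
    intro t h
    cases t <;> simp only [Tm.code, Nat.pair_eq_pair] at h <;> try omega
    rw [F1.idx_injective h.2.1, ih h.2.2]
  | app2 f s s' ih ih' =>
    intro t h
    cases t <;> simp only [Tm.code, Nat.pair_eq_pair] at h <;> try omega
    rw [F2.idx_injective h.2.1, ih h.2.2.1, ih' h.2.2.2]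
  | sub x y z ihx ihy ihz =>
    intro t h
    cases t <;> simp only [Tm.code, Nat.pair_eq_pair] at h <;> try omega
    rw [ihx h.2.1, ihy h.2.2.1, ihz h.2.2.2]

theorem Fm.code_injective : Function.Injective Fm.code := by
  intro φ
  induction φ with
  | eq s t =>
    intro ψ h
    cases ψ <;> simp only [Fm.code, Nat.pair_eq_pair] at h <;> try omega
    rw [Tm.code_injective h.2.1, Tm.code_injective h.2.2]
  | tr t =>
    intro ψ h
    cases ψ <;> simp only [Fm.code, Nat.pair_eq_pair] at h <;> try omega
    rw [Tm.code_injective h.2]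
  | neg φ ih =>
    intro ψ h
    cases ψ <;> simp only [Fm.code, Nat.pair_eq_pair] at h <;> try omega
    rw [ih h.2]
  | or φ χ ih ih' =>
    intro ψ h
    cases ψ <;> simp only [Fm.code, Nat.pair_eq_pair] at h <;> try omega
    rw [ih h.2.1, ih' h.2.2]
  | and φ χ ih ih' =>
    intro ψ h
    cases ψ <;> simp only [Fm.code, Nat.pair_eq_pair] at h <;> try omega
    rw [ih h.2.1, ih' h.2.2]
  | all i φ ih =>
    intro ψ h
    cases ψ <;> simp only [Fm.code, Tm.code, Nat.pair_eq_pair] at h <;> try omega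
    rw [ih h.2.2, h.2.1.2]
  | ex i φ ih =>
    intro ψ h
    cases ψ <;> simp only [Fm.code, Tm.code, Nat.pair_eq_pair] at h <;> try omega
    rw [ih h.2.2, h.2.1.2]

@[simp] theorem Tm.code_inj {s t : Tm} : s.code = t.code ↔ s = t := Tm.code_injective.eq_iff

@[simp] theorem Fm.code_inj {φ ψ : Fm} : φ.code = ψ.code ↔ φ = ψ := Fm.code_injective.eq_iff

/-- Terms carry the tags 1 to 5 and formulas 6 to 12. Hence the two cases in `subFun` never compete.
-/
theorem Fm.code_ne_tmCode (φ : Fm) (t : Tm) : φ.code ≠ t.code := by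
  cases φ <;> cases t <;> simp [Fm.code, Tm.code, Nat.pair_eq_pair]

theorem Tm.code_ne_zero (t : Tm) : t.code ≠ 0 := by
  cases t <;> exact (Nat.lt_of_lt_of_le (by norm_num) (Nat.left_le_pair _ _)).ne'

theorem Fm.code_ne_zero (φ : Fm) : φ.code ≠ 0 := by
  cases φ <;> exact (Nat.lt_of_lt_of_le (by norm_num) (Nat.left_le_pair _ _)).ne'

/-! ### The substitution function -/

theorem partialInv_eq_none {α : Type*} {f : α → ℕ} {n : ℕ} (h : ∀ a, f a ≠ n) :
    Function.partialInv f n = none := by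
  rw [Function.partialInv, dif_neg]
  rintro ⟨a, ha⟩
  exact h a ha

@[simp] theorem Tm.partialInv_code (t : Tm) : Function.partialInv Tm.code t.code = some t :=
  Function.partialInv_left Tm.code_injective t

@[simp] theorem Fm.partialInv_code (φ : Fm) : Function.partialInv Fm.code φ.code = some φ :=
  Function.partialInv_left Fm.code_injective φ

@[simp] theorem Fm.partialInv_tmCode (t : Tm) : Function.partialInv Fm.code t.code = none :=
  partialInv_eq_none fun φ => φ.code_ne_tmCode t

@[simp] theorem subFun_code_fm (φ : Fm) (u : Tm) (i : ℕ) :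
    subFun φ.code u.code (Tm.var i).code = (φ.subst i u).code := by
  simp [subFun]

@[simp] theorem subFun_code_tm (s u : Tm) (i : ℕ) :
    subFun s.code u.code (Tm.var i).code = (s.subst i u).code := by
  simp [subFun]

/-- This is the last clause of `subAx`; it also separates proper values from the default value 0,
which codes nothing. -/
theorem subFun_eq_zero {x t v : ℕ}
    (h : ¬(((∃ i, v = (Tm.var i).code) ∧ ∃ u : Tm, t = u.code) ∧
      ((∃ s : Tm, x = s.code) ∨ ∃ φ : Fm, x = φ.code))) : subFun x t v = 0 := by
  by_cases ht : ∃ u : Tm, t = u.code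
  swap
  · have : Function.partialInv Tm.code t = none := partialInv_eq_none fun a ha => ht ⟨a, ha.symm⟩
    simp [subFun, this]
  obtain ⟨u, rfl⟩ := ht
  by_cases hv : ∃ i, v = (Tm.var i).code
  · obtain ⟨i, rfl⟩ := hv
    have h1 : Function.partialInv Tm.code x = none :=
      partialInv_eq_none fun a ha => h ⟨⟨⟨i, rfl⟩, u, rfl⟩, .inl ⟨a, ha.symm⟩⟩
    have h2 : Function.partialInv Fm.code x = none :=
      partialInv_eq_none fun a ha => h ⟨⟨⟨i, rfl⟩, u, rfl⟩, .inr ⟨a, ha.symm⟩⟩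
    simp [subFun, h1, h2]
  · by_cases hv' : ∃ w : Tm, v = w.code
    · obtain ⟨w, rfl⟩ := hv'
      cases w with
      | var i => exact absurd ⟨i, rfl⟩ hv
      | _ => simp [subFun]
    · have : Function.partialInv Tm.code v = none :=
        partialInv_eq_none fun a ha => hv' ⟨a, ha.symm⟩
      simp [subFun, this]

/-- If a value of the substitution function codes a formula, then so do its arguments, suitably. -/
theorem exists_of_subFun_eq_code {x t v : ℕ} {ψ : Fm} (h : subFun x t v = ψ.code) :
    ∃ (φ : Fm) (u : Tm) (i : ℕ), x = φ.code ∧ t = u.code ∧ v = (Tm.var i).code := by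
  by_contra hn
  by_cases hg : ((∃ i, v = (Tm.var i).code) ∧ ∃ u : Tm, t = u.code) ∧
      ((∃ s : Tm, x = s.code) ∨ ∃ φ : Fm, x = φ.code)
  · obtain ⟨⟨⟨i, rfl⟩, u, rfl⟩, ⟨s, rfl⟩ | ⟨φ, rfl⟩⟩ := hg
    · rw [subFun_code_tm] at h
      exact ψ.code_ne_tmCode _ h.symm
    · exact hn ⟨φ, u, i, rfl, rfl, rfl⟩
  · rw [subFun_eq_zero hg] at h
    exact ψ.code_ne_zero h.symm

/-! ### Evaluation and substitution -/

@[simp] theorem Tm.eval_numeral (e : ℕ → ℕ) (n : ℕ) : (Tm.numeral n).eval e = n := by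
  induction n with
  | zero => rfl
  | succ n ih => simp [Tm.numeral, Tm.eval, F1.interp, ih]

@[simp] theorem Tm.vars_numeral (n : ℕ) : (Tm.numeral n).vars = ∅ := by
  induction n with
  | zero => rfl
  | succ n ih => simpa [Tm.numeral, Tm.vars] using ih

theorem Tm.eval_congr {t : Tm} {e e' : ℕ → ℕ} (h : ∀ i ∈ t.vars, e i = e' i) :
    t.eval e = t.eval e' := by
  induction t <;> simp_all [Tm.eval, Tm.vars]

theorem Fm.sat_congr {φ : Fm} {X : Set ℕ} {e e' : ℕ → ℕ} (h : ∀ i ∈ φ.fv, e i = e' i) :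
    φ.Sat X e ↔ φ.Sat X e' := by
  induction φ generalizing e e' with
  | eq s t =>
    simp only [Fm.fv, Finset.mem_union] at h
    rw [Fm.Sat, Fm.Sat, Tm.eval_congr fun i hi => h i (.inl hi),
      Tm.eval_congr fun i hi => h i (.inr hi)]
  | tr t => rw [Fm.Sat, Fm.Sat, Tm.eval_congr h]
  | neg φ ih => rw [Fm.Sat, Fm.Sat, ih h]
  | or φ ψ ih ih' =>
    simp only [Fm.fv, Finset.mem_union] at h
    rw [Fm.Sat, Fm.Sat, ih fun i hi => h i (.inl hi), ih' fun i hi => h i (.inr hi)]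
  | and φ ψ ih ih' =>
    simp only [Fm.fv, Finset.mem_union] at h
    rw [Fm.Sat, Fm.Sat, ih fun i hi => h i (.inl hi), ih' fun i hi => h i (.inr hi)]
  | all j φ ih =>
    refine forall_congr' fun n => ih fun i hi => ?_
    by_cases hij : i = j
    · simp [hij]
    · simpa [hij] using h i (by simp [Fm.fv, hij, hi])
  | ex j φ ih =>
    refine exists_congr fun n => ih fun i hi => ?_
    by_cases hij : i = j
    · simp [hij]
    · simpa [hij] using h i (by simp [Fm.fv, hij, hi])

theorem Tm.eval_update_of_notMem {t : Tm} {e : ℕ → ℕ} {i n : ℕ} (h : i ∉ t.vars) :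
    t.eval (Function.update e i n) = t.eval e :=
  Tm.eval_congr fun j hj => Function.update_of_ne (by rintro rfl; exact h hj) _ _

theorem Fm.sat_update_of_notMem {φ : Fm} {X : Set ℕ} {e : ℕ → ℕ} {i n : ℕ} (h : i ∉ φ.fv) :
    φ.Sat X (Function.update e i n) ↔ φ.Sat X e :=
  Fm.sat_congr fun j hj => Function.update_of_ne (by rintro rfl; exact h hj) _ _

theorem Fm.IsSentence.holds_iff {φ : Fm} (h : φ.IsSentence) {X : Set ℕ} (e : ℕ → ℕ) :
    Holds X φ ↔ φ.Sat X e :=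
  ⟨fun H => H e, fun H e' => (Fm.sat_congr (by simp [show φ.fv = ∅ from h])).1 H⟩

theorem Tm.vars_subst {t u : Tm} {i : ℕ} (hu : u.vars = ∅) :
    (t.subst i u).vars = t.vars.erase i := by
  induction t with
  | var j =>
    by_cases h : j = i
    · subst h; simp [Tm.subst, Tm.vars, hu]
    · simp [Tm.subst, Tm.vars, h, Finset.erase_eq_of_notMem, Ne.symm h]
  | zero => rfl
  | app1 f t ih => simpa [Tm.subst, Tm.vars] using ih
  | app2 f s t ih ih' => simp [Tm.subst, Tm.vars, ih, ih', Finset.erase_union_distrib]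
  | sub x y z ih ih' ih'' =>
    simp [Tm.subst, Tm.vars, ih, ih', ih'', Finset.erase_union_distrib]

theorem Fm.fv_subst {φ : Fm} {u : Tm} {i : ℕ} (hu : u.vars = ∅) :
    (φ.subst i u).fv = φ.fv.erase i := by
  induction φ with
  | eq s t => simp [Fm.subst, Fm.fv, Tm.vars_subst hu, Finset.erase_union_distrib]
  | tr t => exact Tm.vars_subst hu
  | neg φ ih => exact ih
  | or φ ψ ih ih' => simp [Fm.subst, Fm.fv, ih, ih', Finset.erase_union_distrib]
  | and φ ψ ih ih' => simp [Fm.subst, Fm.fv, ih, ih', Finset.erase_union_distrib]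
  | all j φ ih =>
    by_cases h : j = i
    · simp [Fm.subst, Fm.fv, h]
    · simp [Fm.subst, Fm.fv, h, ih, Finset.erase_right_comm]
  | ex j φ ih =>
    by_cases h : j = i
    · simp [Fm.subst, Fm.fv, h]
    · simp [Fm.subst, Fm.fv, h, ih, Finset.erase_right_comm]

theorem Tm.subst_eq_self {t u : Tm} {i : ℕ} (h : i ∉ t.vars) : t.subst i u = t := by
  induction t with
  | var j =>
    simp only [Tm.vars, Finset.mem_singleton] at h
    simp [Tm.subst, Ne.symm h]
  | _ => simp_all [Tm.subst, Tm.vars]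

theorem Fm.subst_eq_self {φ : Fm} {u : Tm} {i : ℕ} (h : i ∉ φ.fv) : φ.subst i u = φ := by
  induction φ with
  | eq s t =>
    simp only [Fm.fv, Finset.mem_union, not_or] at h
    rw [Fm.subst, Tm.subst_eq_self h.1, Tm.subst_eq_self h.2]
  | tr t => rw [Fm.subst, Tm.subst_eq_self h]
  | neg φ ih => rw [Fm.subst, ih h]
  | or φ ψ ih ih' =>
    simp only [Fm.fv, Finset.mem_union, not_or] at h
    rw [Fm.subst, ih h.1, ih' h.2]
  | and φ ψ ih ih' =>
    simp only [Fm.fv, Finset.mem_union, not_or] at h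
    rw [Fm.subst, ih h.1, ih' h.2]
  | all j φ ih =>
    by_cases hj : j = i
    · simp [Fm.subst, hj]
    · rw [Fm.subst, if_neg hj, ih fun hi => h (by simp [Fm.fv, hi, Ne.symm hj])]
  | ex j φ ih =>
    by_cases hj : j = i
    · simp [Fm.subst, hj]
    · rw [Fm.subst, if_neg hj, ih fun hi => h (by simp [Fm.fv, hi, Ne.symm hj])]

theorem Tm.subst_zero_eq_self_iff {t : Tm} {i : ℕ} : t.subst i .zero = t ↔ i ∉ t.vars := by
  refine ⟨fun h hi => ?_, Tm.subst_eq_self⟩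
  rw [← h, Tm.vars_subst rfl] at hi
  simp at hi

/-- Substituting a closed term removes the free occurrences of the variable, so nothing changes only
if there were none. This justifies the definition of `notFree`. -/
theorem Fm.subst_zero_eq_self_iff {φ : Fm} {i : ℕ} : φ.subst i .zero = φ ↔ i ∉ φ.fv := by
  refine ⟨fun h hi => ?_, Fm.subst_eq_self⟩
  rw [← h, Fm.fv_subst rfl] at hi
  simp at hi

theorem Tm.eval_subst (t : Tm) (i : ℕ) (u : Tm) (e : ℕ → ℕ) :
    (t.subst i u).eval e = t.eval (Function.update e i (u.eval e)) := by
  induction t with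
  | var j => by_cases h : j = i <;> simp [Tm.subst, Tm.eval, h]
  | _ => simp_all [Tm.subst, Tm.eval]

/-- The term `u` may be substituted for the variable `v_i` in the formula. -/
def Fm.FreeFor (i : ℕ) (u : Tm) : Fm → Prop
  | .eq _ _ => True
  | .tr _ => True
  | .neg φ => φ.FreeFor i u
  | .or φ ψ => φ.FreeFor i u ∧ ψ.FreeFor i u
  | .and φ ψ => φ.FreeFor i u ∧ ψ.FreeFor i u
  | .all j φ => j = i ∨ i ∉ φ.fv ∨ (j ∉ u.vars ∧ φ.FreeFor i u)
  | .ex j φ => j = i ∨ i ∉ φ.fv ∨ (j ∉ u.vars ∧ φ.FreeFor i u)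

theorem Fm.sat_subst {φ : Fm} {i : ℕ} {u : Tm} (h : φ.FreeFor i u) {X : Set ℕ} {e : ℕ → ℕ} :
    (φ.subst i u).Sat X e ↔ φ.Sat X (Function.update e i (u.eval e)) := by
  induction φ generalizing e with
  | eq s t => simp [Fm.subst, Fm.Sat, Tm.eval_subst]
  | tr t => simp [Fm.subst, Fm.Sat, Tm.eval_subst]
  | neg φ ih => simp only [Fm.subst, Fm.Sat, ih h]
  | or φ ψ ih ih' => simp only [Fm.subst, Fm.Sat, ih h.1, ih' h.2]
  | and φ ψ ih ih' => simp only [Fm.subst, Fm.Sat, ih h.1, ih' h.2]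
  | all j φ ih =>
    -- If `v_i` is not free in the quantified formula, both sides reduce to its truth under `e`.
    -- Otherwise `FreeFor` yields that `v_j` does not occur in `u`, and the two updates commute.
    by_cases hj : i ∈ (Fm.all j φ).fv
    · have hij : i ≠ j := by rintro rfl; simp [Fm.fv] at hj
      have hi : i ∈ φ.fv := by simp only [Fm.fv, Finset.mem_erase] at hj; exact hj.2
      obtain h | h | h := h
      · exact absurd h hij.symm
      · exact absurd hi h
      · simp only [Fm.subst, if_neg hij.symm, Fm.Sat, ih h.2, Tm.eval_update_of_notMem h.1,
          Function.update_comm hij]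
    · rw [Fm.subst_eq_self hj, Fm.sat_update_of_notMem hj]
  | ex j φ ih =>
    by_cases hj : i ∈ (Fm.ex j φ).fv
    · have hij : i ≠ j := by rintro rfl; simp [Fm.fv] at hj
      have hi : i ∈ φ.fv := by simp only [Fm.fv, Finset.mem_erase] at hj; exact hj.2
      obtain h | h | h := h
      · exact absurd h hij.symm
      · exact absurd hi h
      · simp only [Fm.subst, if_neg hij.symm, Fm.Sat, ih h.2, Tm.eval_update_of_notMem h.1,
          Function.update_comm hij]
    · rw [Fm.subst_eq_self hj, Fm.sat_update_of_notMem hj]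

/-- Only a quantifier on `v_i` could capture a variable of `u`, and no substitution takes place
below it. This covers numerals, `0` and `S v_i`. -/
theorem Fm.freeFor_of_vars_subset {φ : Fm} {i : ℕ} {u : Tm} (h : u.vars ⊆ {i}) :
    φ.FreeFor i u := by
  have hq (j : ℕ) (φ : Fm) (ih : φ.FreeFor i u) :
      j = i ∨ i ∉ φ.fv ∨ (j ∉ u.vars ∧ φ.FreeFor i u) := by
    by_cases hj : j = i
    · exact .inl hj
    · exact .inr (.inr ⟨fun hm => hj (by simpa using h hm), ih⟩)
  induction φ with
  | eq s t => trivial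
  | tr t => trivial
  | neg φ ih => exact ih
  | or φ ψ ih ih' => exact ⟨ih, ih'⟩
  | and φ ψ ih ih' => exact ⟨ih, ih'⟩
  | all j φ ih => exact hq j φ ih
  | ex j φ ih => exact hq j φ ih

theorem Fm.sat_subst_numeral {φ : Fm} {i n : ℕ} {X : Set ℕ} {e : ℕ → ℕ} :
    (φ.subst i (.numeral n)).Sat X e ↔ φ.Sat X (Function.update e i n) := by
  rw [Fm.sat_subst (Fm.freeFor_of_vars_subset (by simp)), Tm.eval_numeral]

/-! ### Satisfaction of formulas built with the level discipline -/

/-- All variables of the term are `v_i` with `i < k`. -/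
def Tm.Below (t : Tm) (k : ℕ) : Prop := ∀ i ∈ t.vars, i < k

theorem Tm.Below.mono {t : Tm} {k m : ℕ} (h : t.Below k) (hkm : k ≤ m) : t.Below m :=
  fun i hi => (h i hi).trans_le hkm

theorem Tm.Below.eval_update {t : Tm} {k : ℕ} (h : t.Below k) {j n : ℕ} {e : ℕ → ℕ}
    (hj : k ≤ j) : t.eval (Function.update e j n) = t.eval e :=
  Tm.eval_update_of_notMem fun hm => absurd (h j hm) (by omega)

@[simp] theorem Tm.below_var {i k : ℕ} : (Tm.var i).Below k ↔ i < k := by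
  simp [Tm.Below, Tm.vars]

@[simp] theorem Tm.below_numeral {n k : ℕ} : (Tm.numeral n).Below k := by simp [Tm.Below]

@[simp] theorem Tm.below_app1 {f : F1} {t : Tm} {k : ℕ} :
    (Tm.app1 f t).Below k ↔ t.Below k := by simp [Tm.Below, Tm.vars]

@[simp] theorem Tm.below_app2 {f : F2} {s t : Tm} {k : ℕ} :
    (Tm.app2 f s t).Below k ↔ s.Below k ∧ t.Below k := by
  simp [Tm.Below, Tm.vars, or_imp, forall_and]

@[simp] theorem Tm.below_sub {x t v : Tm} {k : ℕ} :
    (Tm.sub x t v).Below k ↔ x.Below k ∧ t.Below k ∧ v.Below k := by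
  simp [Tm.Below, Tm.vars, or_imp, forall_and]

/-- The assignments agree on the variables `v_i` with `i < k`. -/
def Agree (k : ℕ) (e' e : ℕ → ℕ) : Prop := ∀ i < k, e' i = e i

@[simp] theorem Agree.rfl {k : ℕ} {e : ℕ → ℕ} : Agree k e e := fun _ _ => Eq.refl _

theorem Agree.update {k j n : ℕ} {e' e : ℕ → ℕ} (h : Agree k e' e) (hj : k ≤ j) :
    Agree k (Function.update e' j n) e := fun i hi => by
  rw [Function.update_of_ne (by omega), h i hi]

theorem agree_update_iff {k j n : ℕ} {e' e : ℕ → ℕ} (hj : k ≤ j) :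
    Agree k (Function.update e' j n) e ↔ Agree k e' e :=
  ⟨fun h i hi => by rw [← h i hi, Function.update_of_ne (by omega)], fun h => h.update hj⟩

theorem Agree.eval {k : ℕ} {e' e : ℕ → ℕ} (h : Agree k e' e) {t : Tm} (ht : t.Below k) :
    t.eval e' = t.eval e := Tm.eval_congr fun i hi => h i (ht i hi)

@[simp] theorem Fm.sat_imp {φ ψ : Fm} {X : Set ℕ} {e : ℕ → ℕ} :
    (Fm.imp φ ψ).Sat X e ↔ (φ.Sat X e → ψ.Sat X e) := by
  simp only [Fm.imp, Fm.Sat]; tauto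

@[simp] theorem Fm.sat_iff {φ ψ : Fm} {X : Set ℕ} {e : ℕ → ℕ} :
    (Fm.iff φ ψ).Sat X e ↔ (φ.Sat X e ↔ ψ.Sat X e) := by
  simp only [Fm.iff, Fm.Sat, Fm.sat_imp]; tauto

@[simp] theorem Fm.sat_disj {l : List Fm} {X : Set ℕ} {e : ℕ → ℕ} :
    (Fm.disj l).Sat X e ↔ ∃ φ ∈ l, φ.Sat X e := by
  induction l with
  | nil => simp [Fm.disj, Fm.Sat, Tm.eval, F1.interp]
  | cons φ l ih =>
    rw [show Fm.disj (φ :: l) = .or φ (Fm.disj l) from rfl, Fm.Sat, ih]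
    simp

theorem F1.mem_list (f : F1) : f ∈ F1.list := by cases f <;> simp [F1.list]

theorem F2.mem_list (f : F2) : f ∈ F2.list := by cases f <;> simp [F2.list]

section levels

variable {X : Set ℕ} {k : ℕ} {e : ℕ → ℕ}

theorem leF_sat {x y : Tm} (hx : x.Below k) (hy : y.Below k) :
    (leF k x y).Sat X e ↔ x.eval e ≤ y.eval e := by
  simp [leF, Fm.Sat, Tm.eval, F2.interp, hx.eval_update, hy.eval_update, le_iff_exists_add,
    eq_comm]

theorem ltF_sat {x y : Tm} (hx : x.Below k) (hy : y.Below k) :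
    (ltF k x y).Sat X e ↔ x.eval e < y.eval e := by
  simp [ltF, Fm.Sat, Tm.eval, F1.interp, F2.interp, hx.eval_update, hy.eval_update,
    Nat.lt_iff_add_one_le, le_iff_exists_add, eq_comm, add_assoc, add_comm]

theorem varF_sat {x : Tm} (hx : x.Below k) :
    (varF k x).Sat X e ↔ ∃ i, x.eval e = (Tm.var i).code := by
  simp [varF, Fm.Sat, Tm.eval, F2.interp, hx.eval_update, dvar, Tm.code]

/-- The numbers generated by a rule: there is a sequence, each entry of which is obtained by the
rule from earlier entries. -/
def Gen (R : ℕ → (ℕ → Prop) → Prop) (x : ℕ) : Prop :=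
  ∃ s n, Nat.beta s n = x ∧ ∀ i ≤ n, R (Nat.beta s i) fun y => ∃ j < i, Nat.beta s j = y

/-- The formula `step` expresses the rule `R`, relative to assignments that agree with `e` on
the variables below `k`. -/
def StepSat (X : Set ℕ) (k : ℕ) (e : ℕ → ℕ) (step : ℕ → Tm → (ℕ → Tm → Fm) → Fm)
    (R : ℕ → (ℕ → Prop) → Prop) : Prop :=
  ∀ (m : ℕ) (c : Tm) (prev : ℕ → Tm → Fm) (e' : ℕ → ℕ) (P : ℕ → Prop),
    k ≤ m → Agree k e' e → c.Below m →
    (∀ (m' : ℕ) (y : Tm) (e'' : ℕ → ℕ), m ≤ m' → y.Below m' → Agree m e'' e' →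
      ((prev m' y).Sat X e'' ↔ P (y.eval e''))) →
    ((step m c prev).Sat X e' ↔ R (c.eval e') P)

/-- The variables at levels `k`, `k + 1`, `k + 2` hold the sequence, its last index and the current
index; the step formula lives at level `k + 3` and above. -/
theorem genF_sat {step : ℕ → Tm → (ℕ → Tm → Fm) → Fm} {R : ℕ → (ℕ → Prop) → Prop} {x : Tm}
    (hx : x.Below k) (h : StepSat X k e step R) : (genF k step x).Sat X e ↔ Gen R (x.eval e) := by
  unfold genF Gen
  simp only [exF, Fm.Sat]
  refine exists_congr fun s => exists_congr fun n => and_congr ?_ (forall_congr' fun i => ?_)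
  · simp [Tm.eval, F2.interp, hx.eval_update]
  · rw [Fm.sat_imp, leF_sat (by simp) (by simp)]
    refine imp_congr (by simp [Tm.eval]) ?_
    set e' := Function.update (Function.update (Function.update e k s) (k + 1) n) (k + 2) i
      with he'
    have hk : e' k = s := by simp [he']
    have hk2 : e' (k + 2) = i := by simp [he']
    rw [h (k + 3) _ _ e' (fun y => ∃ j < i, Nat.beta s j = y) (by omega)
      (by simp [he', agree_update_iff]) (by simp)]
    · simp [Tm.eval, F2.interp, hk, hk2]
    -- The step formula may use `prev` below further quantifiers. These bind variables from `k + 3`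
    -- on, so the sequence and the current index are still read off correctly.
    · intro m y e'' hm hy ha
      simp only [Fm.Sat]
      refine exists_congr fun j => and_congr ?_ ?_
      · rw [ltF_sat (by simp) (by simp; omega)]
        simp only [Tm.eval, Function.update_self]
        rw [Function.update_of_ne (by omega), ha _ (by omega), hk2]
      · simp only [Tm.eval, F2.interp, Function.update_self, hy.eval_update le_rfl]
        rw [Function.update_of_ne (by omega), ha _ (by omega), hk]

end levels

/-! ### Sets generated by a rule -/

/-- A rule that uses only finitely many premises. -/
def Finitary (R : ℕ → (ℕ → Prop) → Prop) : Prop :=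
  ∀ c P, R c P → ∃ l : List ℕ, (∀ y ∈ l, P y) ∧ ∀ Q : ℕ → Prop, (∀ y ∈ l, Q y) → R c Q

/-- Strong induction on the position in the sequence; the rule need not be finitary. -/
theorem Gen.induction {R : ℕ → (ℕ → Prop) → Prop} {Q : ℕ → Prop}
    (h : ∀ c P, R c P → (∀ y, P y → Q y) → Q c) {x : ℕ} (hx : Gen R x) : Q x := by
  obtain ⟨s, n, rfl, H⟩ := hx
  suffices ∀ i ≤ n, Q (Nat.beta s i) from this n le_rfl
  intro i
  induction i using Nat.strong_induction_on with
  | _ i ih =>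
    intro hi
    refine h _ _ (H i hi) ?_
    rintro y ⟨j, hj, rfl⟩
    exact ih j hj (by omega)

/-- Each entry of the list is obtained by the rule from entries to its right. -/
def Derivation (R : ℕ → (ℕ → Prop) → Prop) : List ℕ → Prop
  | [] => True
  | c :: l => R c (· ∈ l) ∧ Derivation R l

/-- `Finitary` entails monotonicity in the premises, so an entry stays justified when more entries
are available. -/
theorem Derivation.append {R : ℕ → (ℕ → Prop) → Prop} (hR : Finitary R) {l l' : List ℕ}
    (h : Derivation R l) (h' : Derivation R l') : Derivation R (l ++ l') := by
  induction l with
  | nil => exact h'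
  | cons c l ih =>
    refine ⟨?_, ih h.2⟩
    obtain ⟨p, hp, H⟩ := hR _ _ h.1
    exact H _ fun y hy => List.mem_append_left _ (hp y hy)

/-- Reversing the list places the premises before the conclusion, and `Nat.unbeta` codes the
reversed list as a sequence. -/
theorem gen_of_derivation {R : ℕ → (ℕ → Prop) → Prop} (hR : Finitary R) {c : ℕ} {l : List ℕ}
    (h : Derivation R (c :: l)) : Gen R c := by
  have hb (i : ℕ) (hi : i < (c :: l).reverse.length) :
      Nat.beta (Nat.unbeta (c :: l).reverse) i = (c :: l).reverse[i] :=
    Nat.beta_unbeta_coe (c :: l).reverse ⟨i, hi⟩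
  have key : ∀ (l : List ℕ), Derivation R l → ∀ i (hi : i < l.reverse.length),
      R l.reverse[i] fun y => ∃ j, ∃ hj : j < i, l.reverse[j] = y := by
    intro l
    induction l with
    | nil => intro _ i hi; simp at hi
    | cons a l ih =>
      intro h i hi
      simp only [List.reverse_cons]
      by_cases hil : i < l.reverse.length
      · obtain ⟨p, hp, H⟩ := hR _ _ (ih h.2 i hil)
        rw [List.getElem_append_left hil]
        refine H _ fun y hy => ?_
        obtain ⟨j, hj, rfl⟩ := hp y hy
        exact ⟨j, hj, by rw [List.getElem_append_left (hj.trans hil)]⟩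
      · have hi' : i = l.reverse.length := by simp at hi hil ⊢; omega
        subst hi'
        obtain ⟨p, hp, H⟩ := hR _ _ h.1
        rw [List.getElem_append_right le_rfl]
        simp only [Nat.sub_self, List.getElem_singleton]
        refine H _ fun y hy => ?_
        obtain ⟨j, hj, rfl⟩ := List.getElem_of_mem (List.mem_reverse.2 (hp y hy))
        exact ⟨j, hj, by rw [List.getElem_append_left hj]⟩
  refine ⟨Nat.unbeta (c :: l).reverse, l.length, ?_, fun i hi => ?_⟩
  · rw [hb _ (by simp)]; simp
  · have hi' : i < (c :: l).reverse.length := by simp; omega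
    rw [hb i hi']
    obtain ⟨p, hp, H⟩ := hR _ _ (key _ h i hi')
    refine H _ fun y hy => ?_
    obtain ⟨j, hj, rfl⟩ := hp y hy
    exact ⟨j, hj, hb j _⟩

theorem Gen.exists_derivation {R : ℕ → (ℕ → Prop) → Prop} (hR : Finitary R) {c : ℕ}
    (h : Gen R c) : ∃ l, Derivation R (c :: l) := by
  refine Gen.induction (Q := fun c => ∃ l, Derivation R (c :: l)) (fun c P hc hP => ?_) h
  obtain ⟨p, hp, H⟩ := hR _ _ hc
  have : ∃ l, Derivation R l ∧ ∀ y ∈ p, y ∈ l := by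
    have hp' : ∀ y ∈ p, ∃ l, Derivation R (y :: l) := fun y hy => hP y (hp y hy)
    clear hp H
    induction p with
    | nil => exact ⟨[], trivial, by simp⟩
    | cons a p ih =>
      obtain ⟨l, hl, hl'⟩ := ih fun y hy => hp' y (by simp [hy])
      obtain ⟨l₁, h₁⟩ := hp' a (by simp)
      refine ⟨(a :: l₁) ++ l, h₁.append hR hl, fun y hy => ?_⟩
      rcases List.mem_cons.1 hy with rfl | hy
      · simp
      · exact List.mem_append_right _ (hl' y hy)
  obtain ⟨l, hl, hl'⟩ := this
  exact ⟨l, H _ hl', hl⟩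

/-- The finitely many premises have derivations, whose concatenation justifies the conclusion. With
`Gen.induction`, this makes `Gen R` the least set closed under a finitary rule `R`. -/
theorem Gen.intro {R : ℕ → (ℕ → Prop) → Prop} (hR : Finitary R) {c : ℕ}
    (h : R c (Gen R)) : Gen R c := by
  obtain ⟨p, hp, H⟩ := hR _ _ h
  suffices ∃ l, Derivation R l ∧ ∀ y ∈ p, y ∈ l by
    obtain ⟨l, hl, hl'⟩ := this
    exact gen_of_derivation hR (l := l) ⟨H _ hl', hl⟩
  clear H
  induction p with
  | nil => exact ⟨[], trivial, by simp⟩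
  | cons a p ih =>
    obtain ⟨l, hl, hl'⟩ := ih fun y hy => hp y (by simp [hy])
    obtain ⟨l₁, h₁⟩ := (hp a (by simp)).exists_derivation hR
    refine ⟨(a :: l₁) ++ l, h₁.append hR hl, fun y hy => ?_⟩
    rcases List.mem_cons.1 hy with rfl | hy
    · simp
    · exact List.mem_append_right _ (hl' y hy)

/-! ### The rules expressed by the arithmetized syntax -/

/-- The meaning of `ctStep`, with the formula `prev` replaced by a predicate on numbers; the later
rules play the same role for their formulas. -/
def CTRule (c : ℕ) (P : ℕ → Prop) : Prop :=
  c = Tm.zero.code ∨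
  (∃ f : F1, ∃ a, P a ∧ c = Nat.pair 3 (Nat.pair f.idx a)) ∨
  (∃ f : F2, ∃ a b, P a ∧ P b ∧ c = Nat.pair 4 (Nat.pair f.idx (Nat.pair a b))) ∨
  ∃ a b d, P a ∧ P b ∧ P d ∧ c = Nat.pair 5 (Nat.pair a (Nat.pair b d))

def TermRule (c : ℕ) (P : ℕ → Prop) : Prop := (∃ i, c = (Tm.var i).code) ∨ CTRule c P

def ForRule (c : ℕ) (P : ℕ → Prop) : Prop :=
  (∃ s t : Tm, c = (Fm.eq s t).code) ∨ (∃ t : Tm, c = (Fm.tr t).code) ∨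
  (∃ a, P a ∧ c = Nat.pair 8 a) ∨
  (∃ a b, P a ∧ P b ∧ c = Nat.pair 9 (Nat.pair a b)) ∨
  (∃ a b, P a ∧ P b ∧ c = Nat.pair 10 (Nat.pair a b)) ∨
  (∃ i a, P a ∧ c = Nat.pair 11 (Nat.pair (Tm.var i).code a)) ∨
  (∃ i a, P a ∧ c = Nat.pair 12 (Nat.pair (Tm.var i).code a))

section

variable {X : Set ℕ} {k : ℕ} {e : ℕ → ℕ}

theorem ctStep_sat : StepSat X k e ctStep CTRule := by
  intro m c prev e' P hm ha hc hp
  simp only [ctStep, Fm.sat_disj, List.mem_append, List.mem_map, List.mem_singleton, or_and_right,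
    exists_or, exists_eq_left, F1.mem_list, F2.mem_list, true_and, CTRule]
  simp [Fm.Sat, hp, agree_update_iff, hc.eval_update, Tm.eval, F2.interp, dzero, dapp1, dapp2,
    dsub, or_assoc]

theorem gen_ctRule_iff {n : ℕ} : Gen CTRule n ↔ ∃ t : Tm, t.vars = ∅ ∧ n = t.code := by
  have hR : Finitary CTRule := by
    rintro c P (h | ⟨f, a, h, rfl⟩ | ⟨f, a, b, h, h', rfl⟩ | ⟨a, b, d, h, h', h'', rfl⟩)
    · exact ⟨[], by simp, fun Q _ => .inl h⟩
    · exact ⟨[a], by simpa, fun Q hQ => .inr (.inl ⟨f, a, hQ a (by simp), rfl⟩)⟩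
    · exact ⟨[a, b], by simp [h, h'], fun Q hQ =>
        .inr (.inr (.inl ⟨f, a, b, hQ a (by simp), hQ b (by simp), rfl⟩))⟩
    · exact ⟨[a, b, d], by simp [h, h', h''], fun Q hQ =>
        .inr (.inr (.inr ⟨a, b, d, hQ a (by simp), hQ b (by simp), hQ d (by simp), rfl⟩))⟩
  constructor
  · refine Gen.induction (Q := fun n => ∃ t : Tm, t.vars = ∅ ∧ n = t.code) ?_
    rintro c P (h | ⟨f, a, h, rfl⟩ | ⟨f, a, b, h, h', rfl⟩ | ⟨a, b, d, h, h', h'', rfl⟩) hP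
    · exact ⟨.zero, rfl, h⟩
    · obtain ⟨t, ht, rfl⟩ := hP a h
      exact ⟨.app1 f t, ht, rfl⟩
    · obtain ⟨t, ht, rfl⟩ := hP a h
      obtain ⟨s, hs, rfl⟩ := hP b h'
      exact ⟨.app2 f t s, by simp [Tm.vars, ht, hs], rfl⟩
    · obtain ⟨t, ht, rfl⟩ := hP a h
      obtain ⟨s, hs, rfl⟩ := hP b h'
      obtain ⟨r, hr, rfl⟩ := hP d h''
      exact ⟨.sub t s r, by simp [Tm.vars, ht, hs, hr], rfl⟩
  · rintro ⟨t, ht, rfl⟩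
    induction t with
    | var i => simp [Tm.vars] at ht
    | zero => exact Gen.intro hR (.inl rfl)
    | app1 f t ih => exact Gen.intro hR (.inr (.inl ⟨f, _, ih ht, rfl⟩))
    | app2 f s t ih ih' =>
      simp only [Tm.vars, Finset.union_eq_empty] at ht
      exact Gen.intro hR (.inr (.inr (.inl ⟨f, _, _, ih ht.1, ih' ht.2, rfl⟩)))
    | sub x y z ih ih' ih'' =>
      simp only [Tm.vars, Finset.union_eq_empty] at ht
      exact Gen.intro hR (.inr (.inr (.inr ⟨_, _, _, ih ht.1.1, ih' ht.1.2, ih'' ht.2, rfl⟩)))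

theorem ctF_sat {x : Tm} (hx : x.Below k) :
    (ctF k x).Sat X e ↔ ∃ t : Tm, t.vars = ∅ ∧ x.eval e = t.code := by
  rw [ctF, genF_sat hx ctStep_sat, gen_ctRule_iff]

theorem gen_termRule_iff {n : ℕ} : Gen TermRule n ↔ ∃ t : Tm, n = t.code := by
  have hR : Finitary TermRule := by
    rintro c P (hv | h | ⟨f, a, h, rfl⟩ | ⟨f, a, b, h, h', rfl⟩ | ⟨a, b, d, h, h', h'', rfl⟩)
    · exact ⟨[], by simp, fun Q _ => .inl hv⟩
    · exact ⟨[], by simp, fun Q _ => .inr (.inl h)⟩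
    · exact ⟨[a], by simpa, fun Q hQ => .inr (.inr (.inl ⟨f, a, hQ a (by simp), rfl⟩))⟩
    · exact ⟨[a, b], by simp [h, h'], fun Q hQ =>
        .inr (.inr (.inr (.inl ⟨f, a, b, hQ a (by simp), hQ b (by simp), rfl⟩)))⟩
    · exact ⟨[a, b, d], by simp [h, h', h''], fun Q hQ =>
        .inr (.inr (.inr (.inr ⟨a, b, d, hQ a (by simp), hQ b (by simp), hQ d (by simp), rfl⟩)))⟩
  constructor
  · refine Gen.induction (Q := fun n => ∃ t : Tm, n = t.code) ?_
    rintro c P (⟨i, h⟩ | h | ⟨f, a, h, rfl⟩ | ⟨f, a, b, h, h', rfl⟩ | ⟨a, b, d, h, h', h'', rfl⟩) hP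
    · exact ⟨.var i, h⟩
    · exact ⟨.zero, h⟩
    · obtain ⟨t, rfl⟩ := hP a h
      exact ⟨.app1 f t, rfl⟩
    · obtain ⟨t, rfl⟩ := hP a h
      obtain ⟨s, rfl⟩ := hP b h'
      exact ⟨.app2 f t s, rfl⟩
    · obtain ⟨t, rfl⟩ := hP a h
      obtain ⟨s, rfl⟩ := hP b h'
      obtain ⟨r, rfl⟩ := hP d h''
      exact ⟨.sub t s r, rfl⟩
  · rintro ⟨t, rfl⟩
    induction t with
    | var i => exact Gen.intro hR (.inl ⟨i, rfl⟩)
    | zero => exact Gen.intro hR (.inr (.inl rfl))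
    | app1 f t ih => exact Gen.intro hR (.inr (.inr (.inl ⟨f, _, ih, rfl⟩)))
    | app2 f s t ih ih' =>
      exact Gen.intro hR (.inr (.inr (.inr (.inl ⟨f, _, _, ih, ih', rfl⟩))))
    | sub x y z ih ih' ih'' =>
      exact Gen.intro hR (.inr (.inr (.inr (.inr ⟨_, _, _, ih, ih', ih'', rfl⟩))))

theorem termF_sat {x : Tm} (hx : x.Below k) :
    (termF k x).Sat X e ↔ ∃ t : Tm, x.eval e = t.code := by
  rw [termF, genF_sat hx (R := TermRule), gen_termRule_iff]
  intro m c prev e' P hm ha hc hp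
  rw [Fm.Sat, varF_sat hc, ctStep_sat m c prev e' P hm ha hc hp]
  rfl

theorem forStep_sat : StepSat X k e forStep ForRule := by
  intro m c prev e' P hm ha hc hp
  simp only [forStep, Fm.sat_disj, List.mem_cons, List.not_mem_nil, or_false, or_and_right,
    exists_or, exists_eq_left, ForRule]
  simp only [Fm.Sat]
  simp [termF_sat, varF_sat, hp, agree_update_iff, hc.eval_update, Tm.eval, F1.interp,
    F2.interp, dtr, Fm.code]

theorem gen_forRule_iff {n : ℕ} : Gen ForRule n ↔ ∃ φ : Fm, n = φ.code := by
  have hR : Finitary ForRule := by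
    rintro c P (h | h | ⟨a, h, rfl⟩ | ⟨a, b, h, h', rfl⟩ | ⟨a, b, h, h', rfl⟩ | ⟨i, a, h, rfl⟩ |
      ⟨i, a, h, rfl⟩)
    · exact ⟨[], by simp, fun Q _ => .inl h⟩
    · exact ⟨[], by simp, fun Q _ => .inr (.inl h)⟩
    · exact ⟨[a], by simpa, fun Q hQ => .inr (.inr (.inl ⟨a, hQ a (by simp), rfl⟩))⟩
    · exact ⟨[a, b], by simp [h, h'], fun Q hQ =>
        .inr (.inr (.inr (.inl ⟨a, b, hQ a (by simp), hQ b (by simp), rfl⟩)))⟩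
    · exact ⟨[a, b], by simp [h, h'], fun Q hQ =>
        .inr (.inr (.inr (.inr (.inl ⟨a, b, hQ a (by simp), hQ b (by simp), rfl⟩))))⟩
    · exact ⟨[a], by simpa, fun Q hQ =>
        .inr (.inr (.inr (.inr (.inr (.inl ⟨i, a, hQ a (by simp), rfl⟩)))))⟩
    · exact ⟨[a], by simpa, fun Q hQ =>
        .inr (.inr (.inr (.inr (.inr (.inr ⟨i, a, hQ a (by simp), rfl⟩)))))⟩
  constructor
  · refine Gen.induction (Q := fun n => ∃ φ : Fm, n = φ.code) ?_
    rintro c P (⟨s, t, h⟩ | ⟨t, h⟩ | ⟨a, h, rfl⟩ | ⟨a, b, h, h', rfl⟩ | ⟨a, b, h, h', rfl⟩ |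
      ⟨i, a, h, rfl⟩ | ⟨i, a, h, rfl⟩) hP
    · exact ⟨_, h⟩
    · exact ⟨_, h⟩
    · obtain ⟨φ, rfl⟩ := hP a h
      exact ⟨.neg φ, rfl⟩
    · obtain ⟨φ, rfl⟩ := hP a h
      obtain ⟨ψ, rfl⟩ := hP b h'
      exact ⟨.or φ ψ, rfl⟩
    · obtain ⟨φ, rfl⟩ := hP a h
      obtain ⟨ψ, rfl⟩ := hP b h'
      exact ⟨.and φ ψ, rfl⟩
    · obtain ⟨φ, rfl⟩ := hP a h
      exact ⟨.all i φ, rfl⟩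
    · obtain ⟨φ, rfl⟩ := hP a h
      exact ⟨.ex i φ, rfl⟩
  · rintro ⟨φ, rfl⟩
    induction φ with
    | eq s t => exact Gen.intro hR (.inl ⟨s, t, rfl⟩)
    | tr t => exact Gen.intro hR (.inr (.inl ⟨t, rfl⟩))
    | neg φ ih => exact Gen.intro hR (.inr (.inr (.inl ⟨_, ih, rfl⟩)))
    | or φ ψ ih ih' => exact Gen.intro hR (.inr (.inr (.inr (.inl ⟨_, _, ih, ih', rfl⟩))))
    | and φ ψ ih ih' =>
      exact Gen.intro hR (.inr (.inr (.inr (.inr (.inl ⟨_, _, ih, ih', rfl⟩)))))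
    | all i φ ih =>
      exact Gen.intro hR (.inr (.inr (.inr (.inr (.inr (.inl ⟨i, _, ih, rfl⟩))))))
    | ex i φ ih =>
      exact Gen.intro hR (.inr (.inr (.inr (.inr (.inr (.inr ⟨i, _, ih, rfl⟩))))))

theorem forF_sat {x : Tm} (hx : x.Below k) :
    (forF k x).Sat X e ↔ ∃ φ : Fm, x.eval e = φ.code := by
  rw [forF, genF_sat hx forStep_sat, gen_forRule_iff]

theorem notFree_sat_fm {v x : Tm} {i : ℕ} {φ : Fm} (hv : v.eval e = (Tm.var i).code)
    (hx : x.eval e = φ.code) : (notFree v x).Sat X e ↔ i ∉ φ.fv := by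
  simp only [notFree, Fm.Sat, Tm.eval, dzero, hv, hx, Tm.eval_numeral]
  rw [subFun_code_fm, Fm.code_inj, Fm.subst_zero_eq_self_iff]

theorem sentF_sat {x : Tm} (hx : x.Below k) :
    (sentF k x).Sat X e ↔ ∃ φ : Fm, φ.IsSentence ∧ x.eval e = φ.code := by
  simp only [sentF, allF, Fm.Sat, forF_sat hx, Fm.sat_imp]
  constructor
  · rintro ⟨⟨φ, hφ⟩, h⟩
    refine ⟨φ, Finset.eq_empty_of_forall_notMem fun i => ?_, hφ⟩
    have := h (Tm.var i).code
    rw [varF_sat (by simp), notFree_sat_fm (i := i) (φ := φ) (by simp [Tm.eval])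
      (by rw [hx.eval_update le_rfl, hφ])] at this
    exact this ⟨i, by simp [Tm.eval]⟩
  · rintro ⟨φ, hs, hφ⟩
    refine ⟨⟨φ, hφ⟩, fun n hn => ?_⟩
    rw [varF_sat (by simp)] at hn
    obtain ⟨i, hi⟩ := hn
    rw [notFree_sat_fm hi (by rw [hx.eval_update le_rfl, hφ]), show φ.fv = ∅ from hs]
    simp

/-! ### Values of closed terms -/

/-- It generates the pairs consisting of the code of a closed term and its value. -/
def ValRule (c : ℕ) (P : ℕ → Prop) : Prop :=
  c = Nat.pair Tm.zero.code 0 ∨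
  (∃ f : F1, ∃ a m, P (Nat.pair a m) ∧
    c = Nat.pair (Nat.pair 3 (Nat.pair f.idx a)) (f.interp m)) ∨
  (∃ f : F2, ∃ a b m n, P (Nat.pair a m) ∧ P (Nat.pair b n) ∧
    c = Nat.pair (Nat.pair 4 (Nat.pair f.idx (Nat.pair a b))) (f.interp m n)) ∨
  ∃ a b d m n p, P (Nat.pair a m) ∧ P (Nat.pair b n) ∧ P (Nat.pair d p) ∧
    c = Nat.pair (Nat.pair 5 (Nat.pair a (Nat.pair b d))) (subFun m n p)

theorem gen_valRule_iff {n y : ℕ} : Gen ValRule (Nat.pair n y) ↔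
    ∃ t : Tm, t.vars = ∅ ∧ n = t.code ∧ ∀ e, t.eval e = y := by
  have hR : Finitary ValRule := by
    rintro c P (h | ⟨f, a, m, h, rfl⟩ | ⟨f, a, b, m, n, h, h', rfl⟩ |
      ⟨a, b, d, m, n, p, h, h', h'', rfl⟩)
    · exact ⟨[], by simp, fun Q _ => .inl h⟩
    · exact ⟨[_], by simpa, fun Q hQ => .inr (.inl ⟨f, a, m, hQ _ (by simp), rfl⟩)⟩
    · exact ⟨[Nat.pair a m, Nat.pair b n], by simp [h, h'], fun Q hQ =>
        .inr (.inr (.inl ⟨f, a, b, m, n, hQ _ (by simp), hQ _ (by simp), rfl⟩))⟩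
    · exact ⟨[Nat.pair a m, Nat.pair b n, Nat.pair d p], by simp [h, h', h''], fun Q hQ =>
        .inr (.inr (.inr ⟨a, b, d, m, n, p, hQ _ (by simp), hQ _ (by simp), hQ _ (by simp), rfl⟩))⟩
  constructor
  · intro h
    -- The induction runs over arbitrary generated numbers, so being a pair is part of the claim.
    have key : ∀ c, Gen ValRule c → ∃ t : Tm, ∃ y, t.vars = ∅ ∧ c = Nat.pair t.code y ∧
        ∀ e, t.eval e = y := by
      intro c
      refine Gen.induction (Q := fun c => ∃ t : Tm, ∃ y, t.vars = ∅ ∧ c = Nat.pair t.code y ∧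
        ∀ e, t.eval e = y) ?_
      rintro c P (h | ⟨f, a, m, h, rfl⟩ | ⟨f, a, b, m, n, h, h', rfl⟩ |
        ⟨a, b, d, m, n, p, h, h', h'', rfl⟩) hP
      · exact ⟨.zero, 0, rfl, h, fun _ => rfl⟩
      · obtain ⟨t, y, ht, h, he⟩ := hP _ h
        obtain ⟨rfl, rfl⟩ := Nat.pair_eq_pair.1 h
        exact ⟨.app1 f t, _, ht, rfl, fun e => by rw [Tm.eval, he]⟩
      · obtain ⟨t, y, ht, h, he⟩ := hP _ h
        obtain ⟨rfl, rfl⟩ := Nat.pair_eq_pair.1 h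
        obtain ⟨t', y, ht', h, he'⟩ := hP _ h'
        obtain ⟨rfl, rfl⟩ := Nat.pair_eq_pair.1 h
        exact ⟨.app2 f t t', _, by simp [Tm.vars, ht, ht'], rfl, fun e => by
          rw [Tm.eval, he, he']⟩
      · obtain ⟨t, y, ht, h, he⟩ := hP _ h
        obtain ⟨rfl, rfl⟩ := Nat.pair_eq_pair.1 h
        obtain ⟨t', y, ht', h, he'⟩ := hP _ h'
        obtain ⟨rfl, rfl⟩ := Nat.pair_eq_pair.1 h
        obtain ⟨t'', y, ht'', h, he''⟩ := hP _ h''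
        obtain ⟨rfl, rfl⟩ := Nat.pair_eq_pair.1 h
        exact ⟨.sub t t' t'', _, by simp [Tm.vars, ht, ht', ht''], rfl, fun e => by
          rw [Tm.eval, he, he', he'']⟩
    obtain ⟨t, z, ht, hc, he⟩ := key _ h
    obtain ⟨rfl, rfl⟩ := Nat.pair_eq_pair.1 hc
    exact ⟨t, ht, rfl, he⟩
  · rintro ⟨t, ht, rfl, he⟩
    -- The value of a closed term does not depend on the assignment; fixing one eliminates `y`
    -- before the induction.
    obtain rfl : t.eval (fun _ => 0) = y := he _
    clear he
    induction t with
    | var i => simp [Tm.vars] at ht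
    | zero => exact Gen.intro hR (.inl rfl)
    | app1 f t ih => exact Gen.intro hR (.inr (.inl ⟨f, _, _, ih ht, rfl⟩))
    | app2 f s t ih ih' =>
      simp only [Tm.vars, Finset.union_eq_empty] at ht
      exact Gen.intro hR (.inr (.inr (.inl ⟨f, _, _, _, _, ih ht.1, ih' ht.2, rfl⟩)))
    | sub x y z ih ih' ih'' =>
      simp only [Tm.vars, Finset.union_eq_empty] at ht
      exact Gen.intro hR (.inr (.inr (.inr
        ⟨_, _, _, _, _, _, ih ht.1.1, ih' ht.1.2, ih'' ht.2, rfl⟩)))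

theorem valF_sat {x y : Tm} (hx : x.Below k) (hy : y.Below k) :
    (valF k x y).Sat X e ↔
      ∃ t : Tm, t.vars = ∅ ∧ x.eval e = t.code ∧ ∀ e', t.eval e' = y.eval e := by
  rw [valF, genF_sat (R := ValRule) (by simp [hx, hy]), Tm.eval, Tm.eval.eq_def]
  · exact gen_valRule_iff
  intro m c prev e' P hm ha hc hp
  simp only [Fm.sat_disj, List.mem_append, List.mem_map, List.mem_singleton, or_and_right,
    exists_or, exists_eq_left, F1.mem_list, F2.mem_list, true_and, ValRule]
  simp [Fm.Sat, hp, agree_update_iff, hc.eval_update, Tm.eval, F2.interp, dzero, dapp1, dapp2,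
    dsub, or_assoc]

theorem valEqF_sat {x y : Tm} (hx : x.Below k) (hy : y.Below k) {s t : Tm}
    (hs : s.vars = ∅) (ht : t.vars = ∅) (hxs : x.eval e = s.code) (hyt : y.eval e = t.code) :
    (valEqF k x y).Sat X e ↔ s.eval e = t.eval e := by
  have hc {u : Tm} (hu : u.vars = ∅) (e' : ℕ → ℕ) : u.eval e' = u.eval e :=
    Tm.eval_congr (by simp [hu])
  simp only [valEqF, exF, Fm.Sat]
  constructor
  · rintro ⟨a, b, h₁, h₂, h₃⟩
    rw [valF_sat (hx.mono (by omega)) (by simp)] at h₁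
    rw [valF_sat (hy.mono (by omega)) (by simp)] at h₂
    obtain ⟨s', -, h, hs'⟩ := h₁
    obtain ⟨t', -, h', ht'⟩ := h₂
    rw [hx.eval_update (by omega), hx.eval_update le_rfl, hxs, Tm.code_inj] at h
    rw [hy.eval_update (by omega), hy.eval_update le_rfl, hyt, Tm.code_inj] at h'
    rw [h, h', hs', ht', h₃]
  · intro h
    refine ⟨s.eval e, t.eval e, ?_, ?_, by simpa [Tm.eval] using h⟩
    · rw [valF_sat (hx.mono (by omega)) (by simp)]
      refine ⟨s, hs, ?_, fun e' => by simp [hc hs, Tm.eval]⟩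
      rw [hx.eval_update (by omega), hx.eval_update le_rfl, hxs]
    · rw [valF_sat (hy.mono (by omega)) (by simp)]
      refine ⟨t, ht, ?_, fun e' => by simp [hc ht, Tm.eval]⟩
      rw [hy.eval_update (by omega), hy.eval_update le_rfl, hyt]

end

/-! ### Soundness of the arithmetized axioms -/

def FreeForRule (t v c : ℕ) (P : ℕ → Prop) : Prop :=
  (∃ s t : Tm, c = (Fm.eq s t).code) ∨ (∃ t : Tm, c = (Fm.tr t).code) ∨
  (∃ a, P a ∧ c = Nat.pair 8 a) ∨
  (∃ a b, P a ∧ P b ∧ c = Nat.pair 9 (Nat.pair a b)) ∨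
  (∃ a b, P a ∧ P b ∧ c = Nat.pair 10 (Nat.pair a b)) ∨
  ∃ u a, (∃ i, u = (Tm.var i).code) ∧ (∃ φ : Fm, a = φ.code) ∧
    (c = Nat.pair 11 (Nat.pair u a) ∨ c = Nat.pair 12 (Nat.pair u a)) ∧
    (subFun c Tm.zero.code v = c ∨ (subFun t Tm.zero.code u = t ∧ P a))

/-- Only this direction is needed: the formula `freeForF` serves as a premise of axioms that are to
be shown true. -/
theorem exists_freeFor_of_gen {u : Tm} {i c : ℕ}
    (h : Gen (FreeForRule u.code (Tm.var i).code) c) : ∃ φ : Fm, c = φ.code ∧ φ.FreeFor i u := by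
  refine Gen.induction (Q := fun c => ∃ φ : Fm, c = φ.code ∧ φ.FreeFor i u) ?_ h
  rintro c P (⟨s, t, h⟩ | ⟨t, h⟩ | ⟨a, h, rfl⟩ | ⟨a, b, h, h', rfl⟩ | ⟨a, b, h, h', rfl⟩ |
    ⟨_, _, ⟨j, rfl⟩, ⟨φ, rfl⟩, hc, h⟩) hP
  · exact ⟨_, h, trivial⟩
  · exact ⟨_, h, trivial⟩
  · obtain ⟨φ, rfl, hφ⟩ := hP a h
    exact ⟨.neg φ, rfl, hφ⟩
  · obtain ⟨φ, rfl, hφ⟩ := hP a h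
    obtain ⟨ψ, rfl, hψ⟩ := hP b h'
    exact ⟨.or φ ψ, rfl, hφ, hψ⟩
  · obtain ⟨φ, rfl, hφ⟩ := hP a h
    obtain ⟨ψ, rfl, hψ⟩ := hP b h'
    exact ⟨.and φ ψ, rfl, hφ, hψ⟩
  -- Both quantifiers are treated at once, since only the free variables of the quantified formula
  -- matter.
  · have key (χ : Fm) (hχ : c = χ.code) (hfv : χ.fv = φ.fv.erase j) :
        j = i ∨ i ∉ φ.fv ∨ (j ∉ u.vars ∧ φ.FreeFor i u) := by
      obtain h | ⟨h, h'⟩ := h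
      · rw [hχ, subFun_code_fm, Fm.code_inj, Fm.subst_zero_eq_self_iff, hfv, Finset.mem_erase] at h
        grind
      · rw [subFun_code_tm, Tm.code_inj, Tm.subst_zero_eq_self_iff] at h
        obtain ⟨ψ, hψ, hf⟩ := hP _ h'
        rw [Fm.code_inj] at hψ
        exact .inr (.inr ⟨h, hψ ▸ hf⟩)
    obtain hc | hc := hc
    · exact ⟨.all j φ, hc, key (.all j φ) hc rfl⟩
    · exact ⟨.ex j φ, hc, key (.ex j φ) hc rfl⟩

section

variable {X : Set ℕ} {k : ℕ} {e : ℕ → ℕ}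

theorem freeForF_sat {t v x : Tm} (ht : t.Below k) (hv : v.Below k) (hx : x.Below k) :
    (freeForF k t v x).Sat X e ↔ Gen (FreeForRule (t.eval e) (v.eval e)) (x.eval e) := by
  rw [freeForF, genF_sat (R := FreeForRule (t.eval e) (v.eval e)) hx]
  intro m c prev e' P hm ha hc hp
  simp only [Fm.sat_disj, List.mem_cons, List.not_mem_nil, or_false, or_and_right,
    exists_or, exists_eq_left, FreeForRule, ← ha.eval ht, ← ha.eval hv]
  simp only [Fm.Sat]
  simp [notFree, Fm.Sat, termF_sat, varF_sat, forF_sat, hp, agree_update_iff, hc.eval_update,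
    (ht.mono hm).eval_update, (hv.mono hm).eval_update, Tm.eval, F1.interp, F2.interp, dtr,
    dzero, Fm.code, or_and_right]

theorem freeFor_of_sat {t v x u : Tm} {i : ℕ} {φ : Fm} (ht : t.Below k) (hv : v.Below k)
    (hx : x.Below k) (h : (freeForF k t v x).Sat X e) (htu : t.eval e = u.code)
    (hvi : v.eval e = (Tm.var i).code) (hxφ : x.eval e = φ.code) : φ.FreeFor i u := by
  rw [freeForF_sat ht hv hx, htu, hvi, hxφ] at h
  obtain ⟨ψ, hψ, hf⟩ := exists_freeFor_of_gen h
  rwa [Fm.code_inj.1 hψ]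

/-- Truth in `(ℕ, X)` for all `X`. -/
def Valid (φ : Fm) : Prop := ∀ X, Holds X φ

theorem exists_valid_of_logAxF {y : Tm} (hy : y.Below k) (h : (logAxF k y).Sat X e) :
    ∃ φ : Fm, y.eval e = φ.code ∧ Valid φ := by
  simp only [logAxF, exF, Fm.Sat] at h
  obtain ⟨a, b, c, v, s, t, ⟨hA, hB, hC⟩, ⟨hV, hS, hT⟩, h⟩ := h
  set e' := Function.update (Function.update (Function.update (Function.update (Function.update
    (Function.update e k a) (k + 1) b) (k + 2) c) (k + 3) v) (k + 4) s) (k + 5) t with he'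
  have hye : y.eval e' = y.eval e :=
    Agree.eval (k := k) (by simp [he', agree_update_iff]) hy
  clear_value e'
  rw [forF_sat (by simp)] at hA hB hC
  rw [termF_sat (by simp)] at hS hT
  rw [varF_sat (by simp)] at hV
  obtain ⟨A, hA⟩ := hA
  obtain ⟨B, hB⟩ := hB
  obtain ⟨C, hC⟩ := hC
  obtain ⟨S, hS⟩ := hS
  obtain ⟨T, hT⟩ := hT
  obtain ⟨i, hV⟩ := hV
  rw [← hye]
  simp only [Fm.sat_disj, List.mem_cons, List.not_mem_nil, or_false, or_and_right,
    exists_or, exists_eq_left] at h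
  -- Stated for an arbitrary term because the equality scheme needs it for both `s` and `t`.
  have hfree {t : Tm} {T : Tm} (ht : t.Below (k + 6)) (hT : t.eval e' = T.code)
      (h : (freeForF (k + 6) t (.var (k + 3)) (.var k)).Sat X e') : A.FreeFor i T :=
    freeFor_of_sat ht (by simp) (by simp) h hT hV hA
  have eA : e' k = A.code := hA
  have eB : e' (k + 1) = B.code := hB
  have eC : e' (k + 2) = C.code := hC
  have eV : e' (k + 3) = (Tm.var i).code := hV
  have eS : e' (k + 4) = S.code := hS
  have eT : e' (k + 5) = T.code := hT
  rcases h with h | h | h | h | h | h | h | ⟨hf, h⟩ | h | ⟨hf, h⟩ | ⟨hf, h⟩ | ⟨hf, h⟩ | h |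
    ⟨⟨hf, hf'⟩, h⟩
  · refine ⟨.imp (.or A A) A, ?_, fun X e => by simp [Fm.Sat]⟩
    rw [show _ = _ from h]; simp only [Tm.eval, F1.interp, F2.interp, eA]; rfl
  · refine ⟨.imp A (.or A B), ?_, fun X e => by simp only [Fm.sat_imp, Fm.Sat]; tauto⟩
    rw [show _ = _ from h]; simp only [Tm.eval, F1.interp, F2.interp, eA, eB]; rfl
  · refine ⟨.imp (.or A B) (.or B A), ?_, fun X e => by simp only [Fm.sat_imp, Fm.Sat]; tauto⟩
    rw [show _ = _ from h]; simp only [Tm.eval, F1.interp, F2.interp, eA, eB]; rfl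
  · refine ⟨.imp (.imp B C) (.imp (.or A B) (.or A C)), ?_, fun X e => by
      simp only [Fm.sat_imp, Fm.Sat]; tauto⟩
    rw [show _ = _ from h]; simp only [Tm.eval, F1.interp, F2.interp, eA, eB, eC]; rfl
  · refine ⟨.imp (.and A B) A, ?_, fun X e => by simp only [Fm.sat_imp, Fm.Sat]; tauto⟩
    rw [show _ = _ from h]; simp only [Tm.eval, F1.interp, F2.interp, eA, eB]; rfl
  · refine ⟨.imp (.and A B) B, ?_, fun X e => by simp only [Fm.sat_imp, Fm.Sat]; tauto⟩
    rw [show _ = _ from h]; simp only [Tm.eval, F1.interp, F2.interp, eA, eB]; rfl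
  · refine ⟨.imp A (.imp B (.and A B)), ?_, fun X e => by
      simp only [Fm.sat_imp, Fm.Sat]; tauto⟩
    rw [show _ = _ from h]; simp only [Tm.eval, F1.interp, F2.interp, eA, eB]; rfl
  · have hF := hfree (by simp) hT hf
    refine ⟨.imp (.all i A) (A.subst i T), ?_, fun X e => ?_⟩
    · rw [show _ = _ from h]
      simp only [Tm.eval, F1.interp, F2.interp, eA, eV, eT, subFun_code_fm]; rfl
    · rw [Fm.sat_imp, Fm.sat_subst hF]
      exact fun h => h _
  · refine ⟨.imp (.all i (.imp A B)) (.imp (.all i A) (.all i B)), ?_, fun X e => ?_⟩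
    · rw [show _ = _ from h]; simp only [Tm.eval, F1.interp, F2.interp, eA, eB, eV]; rfl
    · simp only [Fm.sat_imp, Fm.Sat]
      exact fun h h' n => h n (h' n)
  · rw [notFree_sat_fm hV hA] at hf
    refine ⟨.imp A (.all i A), ?_, fun X e => ?_⟩
    · rw [show _ = _ from h]; simp only [Tm.eval, F1.interp, F2.interp, eA, eV]; rfl
    · simp only [Fm.sat_imp, Fm.Sat]
      exact fun h n => (Fm.sat_update_of_notMem hf).2 h
  · have hF := hfree (by simp) hT hf
    refine ⟨.imp (A.subst i T) (.ex i A), ?_, fun X e => ?_⟩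
    · rw [show _ = _ from h]
      simp only [Tm.eval, F1.interp, F2.interp, eA, eV, eT, subFun_code_fm]; rfl
    · rw [Fm.sat_imp, Fm.sat_subst hF]
      exact fun h => ⟨_, h⟩
  · rw [notFree_sat_fm hV hB] at hf
    refine ⟨.imp (.all i (.imp A B)) (.imp (.ex i A) B), ?_, fun X e => ?_⟩
    · rw [show _ = _ from h]; simp only [Tm.eval, F1.interp, F2.interp, eA, eB, eV]; rfl
    · simp only [Fm.sat_imp, Fm.Sat]
      rintro h ⟨n, hn⟩
      exact (Fm.sat_update_of_notMem hf).1 (h n hn)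
  · refine ⟨.eq T T, ?_, fun X e => rfl⟩
    rw [show _ = _ from h]; simp only [Tm.eval, F2.interp, eT]; rfl
  · have hF := hfree (by simp) hS hf
    have hF' := hfree (by simp) hT hf'
    refine ⟨.imp (.eq S T) (.imp (A.subst i S) (A.subst i T)), ?_, fun X e => ?_⟩
    · rw [show _ = _ from h]
      simp only [Tm.eval, F1.interp, F2.interp, eA, eV, eS, eT, subFun_code_fm]; rfl
    · simp only [Fm.sat_imp, Fm.sat_subst hF, Fm.sat_subst hF', Fm.Sat]
      rintro h; rw [h]; exact id

/-! ### Validity of the non-logical axioms -/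

theorem valid_indAx (i : ℕ) (φ : Fm) : Valid (indAx i φ) := by
  intro X e
  simp only [indAx, Fm.sat_imp, Fm.Sat]
  rw [Fm.sat_subst (Fm.freeFor_of_vars_subset (by simp [Tm.vars]))]
  rintro ⟨h0, hs⟩ n
  induction n with
  | zero => exact h0
  | succ n ih =>
    have := hs n ih
    rw [Fm.sat_subst (Fm.freeFor_of_vars_subset (by simp [Tm.vars]))] at this
    simpa [Tm.eval, F1.interp] using this

theorem subGuard_sat {t v : Tm} {φ ψ : Fm} (ht : t.Below 5) (hv : v.Below 5)
    (h : ∀ (i : ℕ) (u : Tm), v.eval e = (Tm.var i).code → t.eval e = u.code → φ.Sat X e →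
      ψ.Sat X e) : (subGuard t v φ ψ).Sat X e := by
  simp only [subGuard, Fm.sat_imp, Fm.Sat, varF_sat hv, termF_sat ht]
  rintro ⟨⟨⟨i, hi⟩, u, hu⟩, hφ⟩
  exact h i u hi hu hφ

theorem valid_of_mem_subAx {φ : Fm} (h : φ ∈ subAx) : Valid φ := by
  intro X e
  simp only [subAx, List.mem_append, List.mem_cons, List.mem_map, F1.mem_list, F2.mem_list,
    true_and, List.not_mem_nil, or_false, or_assoc] at h
  rcases h with rfl | rfl | rfl | ⟨f, rfl⟩ | ⟨f, rfl⟩ | rfl | rfl | rfl | rfl | rfl | rfl |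
    rfl | rfl | rfl | rfl | rfl
  -- The last equation is the default clause, the only one without `subGuard`.
  rotate_right 1
  · simp only [Fm.sat_imp, Fm.Sat]
    rw [varF_sat (by simp), termF_sat (by simp), termF_sat (by simp), forF_sat (by simp)]
    exact subFun_eq_zero
  all_goals
    refine subGuard_sat (by simp) (by simp) fun i u hv ht hr => ?_
    simp only [Fm.Sat, Tm.eval, dzero, dapp1, dapp2, dsub, dtr, F1.interp, F2.interp,
      Tm.eval_numeral, varF_sat, termF_sat, forF_sat, Tm.below_var, Nat.reduceLT] at hv ht hr ⊢
    rw [ht, hv]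
  · simp [Tm.subst]
  · obtain ⟨⟨j, hj⟩, hne⟩ := hr
    rw [hj, hv, Tm.code_inj] at hne
    rw [hj, subFun_code_tm, Tm.subst, if_neg (by rintro rfl; exact hne rfl)]
  · simp [Tm.subst]
  · obtain ⟨x, hx⟩ := hr
    rw [hx, subFun_code_tm]
    exact subFun_code_tm (.app1 f x) u i
  · obtain ⟨⟨x, hx⟩, y, hy⟩ := hr
    rw [hx, hy, subFun_code_tm, subFun_code_tm]
    exact subFun_code_tm (.app2 f x y) u i
  · obtain ⟨⟨x, hx⟩, ⟨y, hy⟩, z, hz⟩ := hr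
    rw [hx, hy, hz, subFun_code_tm, subFun_code_tm, subFun_code_tm]
    exact subFun_code_tm (.sub x y z) u i
  · obtain ⟨⟨x, hx⟩, y, hy⟩ := hr
    rw [hx, hy, subFun_code_tm, subFun_code_tm]
    exact subFun_code_fm (.eq x y) u i
  · obtain ⟨x, hx⟩ := hr
    rw [hx, subFun_code_tm]
    exact subFun_code_fm (.tr x) u i
  · obtain ⟨x, hx⟩ := hr
    rw [hx, subFun_code_fm]
    exact subFun_code_fm (.neg x) u i
  · obtain ⟨⟨x, hx⟩, y, hy⟩ := hr
    rw [hx, hy, subFun_code_fm, subFun_code_fm]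
    exact subFun_code_fm (.or x y) u i
  · obtain ⟨⟨x, hx⟩, y, hy⟩ := hr
    rw [hx, hy, subFun_code_fm, subFun_code_fm]
    exact subFun_code_fm (.and x y) u i
  · obtain ⟨x, hx⟩ := hr
    rw [hx]
    exact (subFun_code_fm (.all i x) u i).trans (by simp [Fm.subst, Fm.code])
  · obtain ⟨x, hx⟩ := hr
    rw [hx]
    exact (subFun_code_fm (.ex i x) u i).trans (by simp [Fm.subst, Fm.code])
  · obtain ⟨⟨x, hx⟩, ⟨j, hj⟩, hne⟩ := hr
    rw [hj, hv, Tm.code_inj] at hne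
    have hji : j ≠ i := by rintro rfl; exact hne rfl
    rw [hx, hj, subFun_code_fm]
    exact (subFun_code_fm (.all j x) u i).trans (by simp [Fm.subst, Fm.code, hji])
  · obtain ⟨⟨x, hx⟩, ⟨j, hj⟩, hne⟩ := hr
    rw [hj, hv, Tm.code_inj] at hne
    have hji : j ≠ i := by rintro rfl; exact hne rfl
    rw [hx, hj, subFun_code_fm]
    exact (subFun_code_fm (.ex j x) u i).trans (by simp [Fm.subst, Fm.code, hji])

theorem valid_of_mem_paList {φ : Fm} (h : φ ∈ paList) : Valid φ := by
  intro X e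
  simp only [paList, List.mem_append, List.mem_cons, List.not_mem_nil, or_false, or_assoc] at h
  rcases h with rfl | rfl | rfl | rfl | rfl | rfl | rfl | rfl | rfl | rfl | rfl | rfl | rfl | rfl |
    rfl | rfl | rfl | h
  rotate_right 1
  · exact valid_of_mem_subAx h X e
  all_goals
    simp only [Fm.sat_imp, Fm.Sat, Tm.eval, F1.interp, F2.interp, Tm.eval_numeral, dzero, dapp1]
  · simp
  · simp
  · simp
  · rfl
  · simp
  · rfl
  · rw [ltF_sat (by simp) (by simp)]
    simp only [Tm.eval]
    intro h
    rw [Nat.pair, if_pos h]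
  · rw [ltF_sat (by simp) (by simp)]
    simp only [Tm.eval]
    intro h
    rw [Nat.pair, if_neg h]
  · rw [ltF_sat (by simp) (by simp)]
    simp only [Tm.eval, F1.interp, F2.interp, Nat.beta, Nat.unpair_pair]
    -- Beta is a remainder, and the witness is the corresponding quotient.
    refine ⟨Nat.mod_lt _ (Nat.succ_pos _), e 0 / ((e 2 + 1) * e 1 + 1), ?_⟩
    simpa using (Nat.div_add_mod' (e 0) ((e 2 + 1) * e 1 + 1)).symm
  all_goals rfl

theorem exists_valid_of_patAxF {y : Tm} (hy : y.Below k) (h : (patAxF k y).Sat X e) :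
    ∃ φ : Fm, y.eval e = φ.code ∧ Valid φ := by
  simp only [patAxF, exF, Fm.Sat, Fm.sat_disj, List.mem_map] at h
  rcases h with ⟨_, ⟨φ, hφ, rfl⟩, h⟩ | ⟨a, v, hA, hV, h⟩
  · exact ⟨φ, by simpa [Fm.Sat, quo] using h, valid_of_mem_paList hφ⟩
  · rw [forF_sat (by simp)] at hA
    rw [varF_sat (by simp)] at hV
    obtain ⟨A, hA⟩ := hA
    obtain ⟨i, hV⟩ := hV
    refine ⟨indAx i A, ?_, valid_indAx i A⟩
    rw [hy.eval_update (by omega), hy.eval_update le_rfl] at h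
    rw [h]
    simp only [Tm.eval] at hA hV
    simp only [Tm.eval, F1.interp, F2.interp, dzero, dapp1, Tm.eval_numeral, hA, hV]
    rw [subFun_code_fm]
    have := subFun_code_fm A (.app1 .succ (.var i)) i
    simp only [Tm.code] at this ⊢
    rw [this]
    rfl

/-! ### Universal closures -/

theorem Valid.all {φ : Fm} (h : Valid φ) (i : ℕ) : Valid (.all i φ) := fun X _ _ => h X _

theorem Holds.foldr_all {φ : Fm} (h : Holds X φ) (l : List ℕ) : Holds X (l.foldr Fm.all φ) := by
  induction l with
  | nil => exact h
  | cons i l ih => exact fun _ _ => ih _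

theorem Models.closures {A : Set Fm} (h : ∀ φ ∈ A, Holds X φ) : Models X (closures A) := by
  rintro _ ⟨-, φ, hφ, l, rfl⟩
  exact (h φ hφ).foldr_all l

theorem models_PAT (X : Set ℕ) : Models X PAT :=
  Models.closures fun φ hφ => by
    rcases hφ with hφ | ⟨i, χ, rfl⟩
    · exact valid_of_mem_paList hφ X
    · exact valid_indAx i χ X

theorem exists_valid_of_closureF {x y : Tm} (hx : x.Below k) (hy : y.Below k) {φ : Fm}
    (hφ : y.eval e = φ.code) (hv : Valid φ) (h : (closureF k y x).Sat X e) :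
    ∃ φ : Fm, x.eval e = φ.code ∧ Valid φ := by
  rw [closureF, genF_sat (R := fun c P => c = y.eval e ∨
    ∃ i a, P a ∧ c = Nat.pair 11 (Nat.pair (Tm.var i).code a)) hx] at h
  · refine Gen.induction (Q := fun c => ∃ φ : Fm, c = φ.code ∧ Valid φ) ?_ h
    rintro c P (rfl | ⟨i, a, ha, rfl⟩) hP
    · exact ⟨φ, hφ, hv⟩
    · obtain ⟨ψ, rfl, hψ⟩ := hP a ha
      exact ⟨.all i ψ, rfl, hψ.all i⟩
  · intro m c prev e' P hm ha hc hp
    simp [Fm.Sat, varF_sat, hp, agree_update_iff, hc.eval_update, ha.eval hy, Tm.eval, F2.interp]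

theorem exists_valid_of_axPATF {x : Tm} (hx : x.Below k) (h : (axPATF k x).Sat X e) :
    ∃ φ : Fm, φ.IsSentence ∧ x.eval e = φ.code ∧ Valid φ := by
  simp only [axPATF, exF, Fm.Sat, sentF_sat hx] at h
  obtain ⟨⟨φ, hs, hφ⟩, y, h, hc⟩ := h
  obtain ⟨ψ, hψ, hv⟩ := h.elim (exists_valid_of_logAxF (by simp)) (exists_valid_of_patAxF (by simp))
  obtain ⟨χ, hχ, hv'⟩ := exists_valid_of_closureF (hx.mono (by omega)) (by simp) hψ hv hc
  rw [hx.eval_update le_rfl, hφ, Fm.code_inj] at hχ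
  exact ⟨φ, hs, hφ, hχ ▸ hv'⟩

end

/-! ### Fixed points of the jump -/

/-- Needed for the dotted formula in `vf8` to become a sentence; the formula is concrete, so this is
a finite computation. -/
theorem fv_sentF_var : (sentF 1 (.var 0)).fv ⊆ {0} := by decide +kernel

theorem Fm.isSentence_subst_numeral {φ : Fm} {i n : ℕ} (h : φ.fv ⊆ {i}) :
    (φ.subst i (.numeral n)).IsSentence := by
  rw [Fm.IsSentence, Fm.fv_subst (by simp)]
  refine Finset.eq_empty_of_forall_notMem fun j hj => ?_
  rw [Finset.mem_erase] at hj
  exact hj.1 (by simpa using h hj.2)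

theorem dot_eval (φ : Fm) (i : ℕ) (x : Tm) (e : ℕ → ℕ) :
    (dot φ i x).eval e = (φ.subst i (.numeral (x.eval e))).code := by
  simp [dot, quo, quoVar, Tm.eval, F1.interp]

/-- Dotting `v_i` substitutes the numeral of `e i`, which does not affect satisfaction under `e`.
The claim is generalised over the accumulator of the fold. -/
theorem dots_eval (φ : Fm) (l : List ℕ) (e : ℕ → ℕ) :
    ∃ ψ : Fm, (dots φ l).eval e = ψ.code ∧ ∀ X, ψ.Sat X e ↔ φ.Sat X e := by
  suffices ∀ (q : Tm) (χ : Fm), q.eval e = χ.code → (∀ X, χ.Sat X e ↔ φ.Sat X e) →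
      ∃ ψ : Fm, (l.foldl (fun q i => Tm.sub q (.num (.var i)) (quoVar i)) q).eval e = ψ.code ∧
        ∀ X, ψ.Sat X e ↔ φ.Sat X e from
    this (quo φ) φ (by simp [quo]) fun _ => Iff.rfl
  induction l with
  | nil => exact fun q χ hq hχ => ⟨χ, hq, hχ⟩
  | cons i l ih =>
    refine fun q χ hq hχ => ih _ (χ.subst i (.numeral (e i))) ?_ fun X => ?_
    · simp [Tm.eval, hq, quoVar, F1.interp]
    · rw [Fm.sat_subst_numeral, Function.update_eq_self, hχ]

section

variable {X : Set ℕ}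

/-- The interpretations of `Tr` over which the scheme VB quantifies. -/
def Admissible (X X' : Set ℕ) : Prop := X' ⊆ SentCodes ∧ X ⊆ X' ∧ X' ∩ anti X = ∅

/-- The fixed-point equation in usable form; for a sentence, one assignment is as good as all. -/
theorem code_mem_iff (hfix : X = jumpVB X) {φ : Fm} (h : φ.IsSentence) (e : ℕ → ℕ) :
    φ.code ∈ X ↔ ∀ X', Admissible X X' → φ.Sat X' e := by
  constructor
  · intro hm X' ⟨h₁, h₂, h₃⟩
    rw [hfix] at hm
    obtain ⟨ψ, hψ, hc, hs⟩ := hm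
    rw [Fm.code_inj.1 hc]
    exact hs X' h₁ h₂ h₃ e
  · intro H
    rw [hfix]
    exact ⟨φ, h, rfl, fun X' h₁ h₂ h₃ => (h.holds_iff e).2 (H X' ⟨h₁, h₂, h₃⟩)⟩

theorem exists_sentence_of_mem (hfix : X = jumpVB X) {n : ℕ} (h : n ∈ X) :
    ∃ φ : Fm, φ.IsSentence ∧ n = φ.code := by
  rw [hfix] at h
  obtain ⟨φ, hφ, hn, -⟩ := h
  exact ⟨φ, hφ, hn⟩

theorem isSentence_of_mem (hfix : X = jumpVB X) {φ : Fm} (h : φ.code ∈ X) : φ.IsSentence := by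
  obtain ⟨ψ, hψ, hc⟩ := exists_sentence_of_mem hfix h
  rwa [Fm.code_inj.1 hc]

theorem admissible_self (hcons : Consistent X) (hfix : X = jumpVB X) : Admissible X X :=
  ⟨fun _ hn => exists_sentence_of_mem hfix hn, subset_rfl, hcons⟩

theorem code_mem_anti {φ : Fm} (hφ : φ.IsSentence) : φ.code ∈ anti X ↔ (Fm.neg φ).code ∈ X := by
  constructor
  · rintro ⟨ψ, -, hc, h⟩
    rwa [Fm.code_inj.1 hc]
  · exact fun h => ⟨φ, hφ, rfl, h⟩

theorem holds_of_truthAx (hcons : Consistent X) (hfix : X = jumpVB X) {φ : Fm}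
    (h : TruthAx φ) : Holds X φ := by
  intro e
  have hXX := admissible_self hcons hfix
  cases h with
  | vf1 =>
    simp only [Fm.sat_imp, Fm.sat_iff, Fm.Sat]
    rw [ctF_sat (by simp), ctF_sat (by simp)]
    rintro ⟨⟨s, hs, hxs⟩, t, ht, hyt⟩
    rw [valEqF_sat (by simp) (by simp) hs ht hxs hyt]
    have hS : (Fm.eq s t).IsSentence := by simp [Fm.IsSentence, Fm.fv, hs, ht]
    simp only [Tm.eval, F1.interp, F2.interp] at hxs hyt ⊢
    rw [hxs, hyt, show Nat.pair 6 (Nat.pair s.code t.code) = (Fm.eq s t).code from rfl,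
      show Nat.pair 8 (Fm.eq s t).code = (Fm.neg (.eq s t)).code from rfl,
      code_mem_iff hfix hS e, code_mem_iff hfix (φ := .neg (.eq s t)) hS e]
    -- Equations do not mention `Tr`, so all admissible sets agree on them, and `X` is one.
    exact ⟨⟨fun h => h X hXX, fun h _ _ => h⟩, ⟨fun h => h X hXX, fun h _ _ => h⟩⟩
  | vf2 =>
    simp only [Fm.sat_imp, Fm.Sat]
    intro h
    obtain ⟨φ, hφ, hx, hv⟩ := exists_valid_of_axPATF (by simp) h
    rw [hx, code_mem_iff hfix hφ e]
    exact fun X' _ => hv X' e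
  | vf3 =>
    simp only [Fm.sat_imp, Fm.Sat]
    intro h
    simp only [Tm.eval, F1.interp, F2.interp, Function.update_self, ne_eq, OfNat.zero_ne_ofNat,
      not_false_eq_true, Function.update_of_ne, OfNat.one_ne_ofNat] at h ⊢
    -- The axiom has no guard on `x` and `v`. That they code a formula and a variable follows from
    -- the instance at 0, which codes a sentence.
    obtain ⟨ψ, -, hψ⟩ := exists_sentence_of_mem hfix (h 0)
    obtain ⟨φ, u, i, hx, -, hv⟩ := exists_of_subFun_eq_code hψ
    rw [hx, hv] at h ⊢
    simp only [subFun_code_fm] at h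
    have hs (n : ℕ) : (φ.subst i (.numeral n)).IsSentence := isSentence_of_mem hfix (h n)
    have hall : (Fm.all i φ).IsSentence := by
      have := hs 0
      rwa [Fm.IsSentence, Fm.fv_subst (by simp)] at this
    rw [show Nat.pair 11 (Nat.pair (Tm.var i).code φ.code) = (Fm.all i φ).code from rfl,
      code_mem_iff hfix hall e]
    intro X' hX' n
    exact Fm.sat_subst_numeral.1 ((code_mem_iff hfix (hs n) e).1 (h n) X' hX')
  | vf4 =>
    simp only [Fm.sat_imp, Fm.Sat, dot_eval]
    intro h
    rw [code_mem_iff hfix (Fm.isSentence_subst_numeral (by simp [Fm.fv, Tm.vars])) e]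
    intro X' hX'
    rw [Fm.sat_subst_numeral]
    simpa [Fm.Sat, Tm.eval] using hX'.2.1 h
  | vf5 =>
    simp only [Fm.sat_imp, Fm.sat_iff, Fm.Sat, dot_eval]
    rw [sentF_sat (by simp)]
    rintro ⟨φ, hφ, hx⟩
    rw [code_mem_iff hfix (Fm.isSentence_subst_numeral (by simp [Fm.fv, Tm.vars])) e]
    simp only [Fm.sat_subst_numeral, Fm.Sat, Tm.eval, F1.interp, Function.update_self] at hx ⊢
    rw [hx, show Nat.pair 8 φ.code = (Fm.neg φ).code from rfl, ← code_mem_anti hφ]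
    constructor
    · intro h
      by_contra hn
      -- Adding `φ` keeps the set admissible, since `φ` is outside `anti X` and consistency is
      -- tested only against `anti X`.
      refine h (insert φ.code X) ⟨?_, Set.subset_insert _ _, ?_⟩ (Set.mem_insert _ _)
      · exact Set.insert_subset ⟨φ, hφ, rfl⟩ hXX.1
      · rw [Set.insert_inter_of_notMem hn]
        exact hcons
    · intro h X' hX' hm
      exact hX'.2.2.subset ⟨hm, h⟩
  | vf6 =>
    simp only [Fm.sat_imp, Fm.Sat, Tm.eval, F1.interp, F2.interp]
    intro h hx
    obtain ⟨φ, hφ, hx'⟩ := exists_sentence_of_mem hfix hx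
    obtain ⟨χ, hχ, hc⟩ := exists_sentence_of_mem hfix h
    rw [hc] at h
    -- The tag 9 leaves only a disjunction; its right disjunct inherits being a sentence.
    cases χ <;> simp only [Fm.code, Nat.pair_eq_pair] at hc <;> try omega
    rename_i θ ψ
    obtain ⟨-, hθ, hψ⟩ := hc
    rw [hx', show Nat.pair 8 φ.code = (Fm.neg φ).code from rfl, Fm.code_inj] at hθ
    subst hθ
    have hS : ψ.IsSentence := by
      simp only [Fm.IsSentence, Fm.fv, Finset.union_eq_empty] at hχ
      exact hχ.2
    rw [hx', code_mem_iff hfix hφ e] at hx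
    rw [code_mem_iff hfix hχ e] at h
    rw [hψ, code_mem_iff hfix hS e]
    exact fun X' hX' => Fm.sat_imp.1 (h X' hX') (hx X' hX')
  | vf7 =>
    simp only [Fm.sat_imp, Fm.Sat, dot_eval]
    intro h
    rw [code_mem_iff hfix (Fm.isSentence_subst_numeral (by simp [Fm.fv, Tm.vars])) e]
    simp only [Tm.eval] at h
    obtain ⟨φ, hφ, hx⟩ := exists_sentence_of_mem hfix h
    intro X' hX'
    simp only [Fm.sat_subst_numeral, Fm.Sat, Tm.eval, F1.interp, Function.update_self]
    rw [hx] at h ⊢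
    intro hm
    -- `¬¬φ` holds wherever `φ` does, so it belongs to the fixed point, which puts `¬φ` in the
    -- antiextension.
    have hn : (Fm.neg φ).code ∈ anti X := by
      rw [code_mem_anti (φ := .neg φ) hφ, code_mem_iff hfix (φ := .neg (.neg φ)) hφ e]
      exact fun X' hX' => not_not.2 ((code_mem_iff hfix hφ e).1 h X' hX')
    exact hX'.2.2.subset ⟨hm, hn⟩
  | vf8 =>
    simp only [Fm.Sat, dot_eval]
    rw [code_mem_iff hfix (Fm.isSentence_subst_numeral ?_) e]
    · intro X' hX'
      simp only [Fm.sat_subst_numeral, Fm.sat_imp]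
      rw [sentF_sat (by simp)]
      exact fun h => hX'.1 h
    · simp only [Fm.imp, Fm.fv, Tm.vars]
      exact Finset.union_subset subset_rfl fv_sentF_var
  | vf9 φ l =>
    simp only [Fm.sat_imp, Fm.Sat]
    obtain ⟨ψ, hψ, hs⟩ := dots_eval φ l e
    rw [hψ, ← hs]
    -- Membership in `X` forces `ψ` to be a sentence, so undotted free variables cause no problem;
    -- then `X' = X` is used.
    exact fun h => (code_mem_iff hfix (isSentence_of_mem hfix h) e).1 h X hXX

end

end VB

theorem mainTheorem9 (X : Set ℕ) (hcons : VB.Consistent X) (hfix : X = VB.jumpVB X) :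
    VB.Models X VB.VFminus := by
  rintro φ (hφ | hφ)
  · exact VB.models_PAT X φ hφ
  · exact VB.Models.closures (fun _ => VB.holds_of_truthAx hcons hfix) φ hφ
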